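/- Let $\mathcal A(t)=e^{|t|}-1-|t|$. For an open set $\Omega\subset\mathbb R^2$ let $H^1(\Omega)$ be the space of complex-valued $u\in L^2(\Omega)$ whose weak gradient $\nabla u$ belongs to $L^2(\Omega)$, let $H^1_0(\Omega)$ be the closure of $C_c^\infty(\Omega)$ in $H^1(\Omega)$, let $|\Omega|$ be the Lebesgue measure of $\Omega$, and let $\|\nabla u\|^2=\int_\Omega|\nabla u|^2\,dx$. A cube is an open square with edges parallel to the coordinate axes. A function $u\in H^1(\Omega)$ is said to vanish near a set $K$ if there is an open set $U\supset K$ such that $u=0$ almost everywhere on $U\cap\Omega$. (i) There is a constant $S_2>0$ such that for any open set $\Omega\subset\mathbb R^2$ of finite measure and any $u\in H^1_0(\Omega)$, $$\int_\Omega \mathcal A\left(\frac{S_2|u|^2}{\|\nabla u\|^2}\right)dx\le|\Omega| .$$ (ii) There is a constant $S_2'>0$ such that for any open set $\Omega\subset\mathbb R^2$, any cube $Q\supset\Omega$ and any $u\in H^1(\Omega)$ which vanishes near $Q\cap\partial\Omega$ and satisfies $\int_\Omega u\,dx=0$, $$\int_\Omega \mathcal A\left(\frac{S_2'|u|^2}{\|\nabla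 u\|^2}\right)dx\le|\Omega| .$$ In both parts, if $\|\nabla u\|=0$, then $u=0$ almost everywhere on $\Omega$, and the quotient $|u|^2/\|\nabla u\|^2$ is read as $0$. -/

import Mathlib

open MeasureTheory
open scoped ENNReal ContDiff

noncomputable section

/-- The Young function `𝓐(t) = e^{|t|} - 1 - |t|`. -/
def youngA (t : ℝ) : ℝ := Real.exp |t| - 1 - |t|

/-- The Euclidean plane `ℝ²`. -/
abbrev Plane : Type := EuclideanSpace ℝ (Fin 2)

/-- `φ ∈ C_c^∞(Ω)`: `φ` is smooth, complex-valued, and has compact support contained in `Ω`. -/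
structure IsTestFunction (Ω : Set Plane) (φ : Plane → ℂ) : Prop where
  contDiff : ContDiff ℝ ∞ φ
  hasCompactSupport : HasCompactSupport φ
  tsupport_subset : tsupport φ ⊆ Ω

/-- The partial derivative `∂ᵢ φ` in the `i`-th coordinate direction. -/
def partialDeriv (i : Fin 2) (φ : Plane → ℂ) (x : Plane) : ℂ :=
  fderiv ℝ φ x (EuclideanSpace.single i 1)

/-- The classical gradient `(∂₀ φ, ∂₁ φ)`, with values in `ℂ²` with its Euclidean norm. -/
def classicalGrad (φ : Plane → ℂ) (x : Plane) : EuclideanSpace ℂ (Fin 2) :=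
  WithLp.toLp 2 fun i => partialDeriv i φ x

/-- `u ∈ H¹(Ω)` with `∇u = g`: both `u` and `g` are in `L²(Ω)`, and `g` is the weak (distributional)
gradient of `u` on `Ω`. Such a `g` is unique up to equality almost everywhere on `Ω`. -/
structure HasH1Grad (Ω : Set Plane) (u : Plane → ℂ) (g : Plane → EuclideanSpace ℂ (Fin 2)) :
    Prop where
  memLp : MemLp u 2 (volume.restrict Ω)
  memLp_grad : MemLp g 2 (volume.restrict Ω)
  integral_eq : ∀ φ : Plane → ℂ, IsTestFunction Ω φ → ∀ i : Fin 2,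
    ∫ x in Ω, u x * partialDeriv i φ x = -∫ x in Ω, g x i * φ x

/-- `u ∈ H¹₀(Ω)` with `∇u = g`: `u ∈ H¹(Ω)` has weak gradient `g` and lies in the closure of
`C_c^∞(Ω)` in the norm of `H¹(Ω)`. -/
structure HasH10Grad (Ω : Set Plane) (u : Plane → ℂ) (g : Plane → EuclideanSpace ℂ (Fin 2)) :
    Prop extends HasH1Grad Ω u g where
  exists_approx : ∀ ε : ℝ≥0∞, 0 < ε → ∃ φ : Plane → ℂ, IsTestFunction Ω φ ∧
    eLpNorm (fun x => u x - φ x) 2 (volume.restrict Ω) < ε ∧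
    eLpNorm (fun x => g x - classicalGrad φ x) 2 (volume.restrict Ω) < ε

/-- `‖g‖² = ∫_Ω |g|² dx`, to be applied to `g = ∇u`. -/
def l2NormSq (Ω : Set Plane) (g : Plane → EuclideanSpace ℂ (Fin 2)) : ℝ :=
  ∫ x in Ω, ‖g x‖ ^ 2

/-- The open cube with centre `a`, side length `L` and edges parallel to the coordinate axes. -/
def openCube (a : Plane) (L : ℝ) : Set Plane :=
  {x | ∀ i, |x i - a i| < L / 2}

/-- `u`, a function on `Ω`, vanishes near the set `K`: there is an open neighbourhood `U` of `K`
such that `u = 0` almost everywhere on `U ∩ Ω`. -/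
def VanishesNear (Ω K : Set Plane) (u : Plane → ℂ) : Prop :=
  ∃ U : Set Plane, IsOpen U ∧ K ⊆ U ∧ ∀ᵐ x ∂(volume.restrict (U ∩ Ω)), u x = 0

end

/-!
Both parts follow from one estimate on a cube `Q`. Let `u` have the weak gradient `g` on `Q`, with `g`
supported in a set `E`. For almost every `x ∈ Q`,

  `|u(x) - u_Q| ≤ 12 ∫_E |g(y)| / |x - y| dy`,

where `u_Q` is the average of `u` over `Q` (`ae_enorm_sub_cubeAverage_le`). To see this, contract `Q`
towards `x` by the factors `2⁻ʲ`. The averages over the contracted cubes tend to `u(x)` by Lebesgue's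
differentiation theorem, and two consecutive averages differ by at most `3 / ℓ` times the integral
of `|g|` over the larger cube, `ℓ` being its side (`norm_average_sub_average_le`, where the weak
gradient is tested against smoothed differences of one-dimensional distribution functions). The sum
of the weights `3 / ℓ` over the cubes that contain `y` is geometric, hence at most `12 / |x - y|`.

The Riesz potential `V` on the right satisfies, by two applications of Hölder's inequality,

  `∫_E V^{2k} ≤ ‖g‖^{2k} |E| · 8 (8k)^k`  (`lintegral_rieszPotential_pow_le`).

As `k^k ≤ 3^k k!`, the power series of the Young function can be summed, and
`∫_E 𝓐(S |u - u_Q|² / ‖g‖²) ≤ |E|` for a small absolute `S` (`lintegral_youngA_le`). The right-hand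
side is the measure of `E`, not of `Q`, because the gradient lives on `E`.

In part (ii), `u` extended by zero from `Ω` to `Q` is in `H¹(Q)` because it vanishes near `Q ∩ ∂Ω`
(`HasH1Grad.integral_mul_partialDeriv_of_vanishesNear`), and `u_Q = 0`. In part (i), the extension
by zero is in `H¹` of every cube (`HasH10Grad.integral_mul_partialDeriv`); along growing cubes the
averages tend to zero, and Fatou's lemma gives the claim.
-/

/-! ### Moments of Riesz potentials -/

lemma lintegral_ball_inv_enorm_rpow (x : Plane) {τ R : ℝ} (hτ : 0 < τ) (hR : 0 < R) :
    ∫⁻ y in Metric.ball x R, (‖x - y‖ₑ⁻¹) ^ (2 - τ) = ENNReal.ofReal (2 * Real.pi * R ^ τ / τ) := by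
  -- By translation the ball may be centred at the origin.
  have hshift : ∫⁻ y in Metric.ball x R, (‖x - y‖ₑ⁻¹) ^ (2 - τ)
      = ∫⁻ z in Metric.ball (0 : Plane) R, (‖z‖ₑ⁻¹) ^ (2 - τ) := by
    rw [← lintegral_indicator measurableSet_ball, ← lintegral_indicator measurableSet_ball,
      ← lintegral_sub_left_eq_self _ x]
    refine lintegral_congr fun y => ?_
    by_cases hy : ‖y‖ < R <;> simp [Set.indicator, dist_eq_norm, hy]
  have hpow : ∀ t ∈ Set.Ioo 0 R, t ^ (Module.finrank ℝ Plane - 1) • t ^ (τ - 2) = t ^ (τ - 1) := by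
    intro t ht
    have h2 : Module.finrank ℝ Plane = 2 := by simp
    rw [h2, smul_eq_mul, show τ - 1 = 1 + (τ - 2) by ring, Real.rpow_add ht.1, Real.rpow_one]
    simp
  have hint : IntegrableOn (fun t : ℝ => t ^ (τ - 1)) (Set.Ioo 0 R) := by
    have := (intervalIntegral.intervalIntegrable_rpow' (a := 0) (b := R)
      (show -1 < τ - 1 by linarith)).1
    exact this.mono_set Set.Ioo_subset_Ioc_self
  have hI : IntegrableOn (fun z : Plane => ‖z‖ ^ (τ - 2)) (Metric.ball 0 R) := by
    rw [integrableOn_fun_norm_addHaar volume (f := fun t : ℝ => t ^ (τ - 2))]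
    exact hint.congr_fun (fun t ht => (hpow t ht).symm) measurableSet_Ioo
  have hval : ∫ z in Metric.ball (0 : Plane) R, ‖z‖ ^ (τ - 2) = 2 * Real.pi * R ^ τ / τ := by
    have e : ∫ z in Metric.ball (0 : Plane) R, ‖z‖ ^ (τ - 2)
        = ∫ z : Plane, (Set.Iio R).indicator (fun t : ℝ => t ^ (τ - 2)) ‖z‖ := by
      rw [← integral_indicator measurableSet_ball]
      refine integral_congr_ae (Filter.Eventually.of_forall fun z => ?_)
      by_cases hz : ‖z‖ < R <;> simp [Set.indicator, hz]
    have e2 : ∫ t in Set.Ioi (0 : ℝ), t ^ (Module.finrank ℝ Plane - 1) •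
        (Set.Iio R).indicator (fun t : ℝ => t ^ (τ - 2)) t = R ^ τ / τ := by
      have : ∫ t in Set.Ioi (0 : ℝ), t ^ (Module.finrank ℝ Plane - 1) •
        (Set.Iio R).indicator (fun t : ℝ => t ^ (τ - 2)) t
          = ∫ t in Set.Ioo 0 R, t ^ (τ - 1) := by
        rw [← Set.Ioi_inter_Iio, ← setIntegral_indicator measurableSet_Iio]
        refine setIntegral_congr_fun measurableSet_Ioi fun t ht => ?_
        by_cases h : t < R
        · simp only [Set.indicator, Set.mem_Iio, h, if_true]
          exact hpow t ⟨ht, h⟩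
        · simp [Set.indicator, h]
      rw [this, ← integral_Ioc_eq_integral_Ioo, ← intervalIntegral.integral_of_le hR.le,
        integral_rpow (Or.inl (by linarith))]
      simp [Real.zero_rpow hτ.ne']
    rw [e, integral_fun_norm_addHaar, e2]
    simp [Measure.real, EuclideanSpace.volume_ball_fin_two, Real.pi_pos.le]
    ring
  rw [hshift, ← hval, ofReal_integral_eq_lintegral_ofReal hI
    (Filter.Eventually.of_forall fun z => by positivity)]
  refine lintegral_congr_ae ?_
  filter_upwards [ae_restrict_of_ae (Measure.ae_ne volume (0 : Plane))] with z hz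
  have hz' : 0 < ‖z‖ := norm_pos_iff.mpr hz
  rw [← ofReal_norm, ← ENNReal.ofReal_inv_of_pos hz', ENNReal.ofReal_rpow_of_pos (by positivity),
    Real.inv_rpow hz'.le, ← Real.rpow_neg hz'.le]
  congr 2; ring

/-- Among the sets of given area, the disc about `x` is the worst one, up to the constant:
outside the disc of radius `m` the kernel is at most `m ^ (τ - 2)`. -/
lemma setLIntegral_inv_enorm_rpow_le (x : Plane) {τ m : ℝ} (hτ : 0 < τ) (hτ' : τ ≤ 2) (hm : 0 < m)
    {E : Set Plane} (hE : MeasurableSet E) (hEm : volume E = ENNReal.ofReal (m ^ 2)) :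
    ∫⁻ y in E, (‖x - y‖ₑ⁻¹) ^ (2 - τ) ≤ ENNReal.ofReal ((2 * Real.pi / τ + 1) * m ^ τ) := by
  have h1 : ∫⁻ y in E ∩ Metric.ball x m, (‖x - y‖ₑ⁻¹) ^ (2 - τ)
      ≤ ENNReal.ofReal (2 * Real.pi * m ^ τ / τ) :=
    (lintegral_mono_set Set.inter_subset_right).trans (lintegral_ball_inv_enorm_rpow x hτ hm).le
  have h2 : ∫⁻ y in E \ Metric.ball x m, (‖x - y‖ₑ⁻¹) ^ (2 - τ) ≤ ENNReal.ofReal (m ^ τ) := by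
    calc ∫⁻ y in E \ Metric.ball x m, (‖x - y‖ₑ⁻¹) ^ (2 - τ)
        ≤ ∫⁻ _ in E \ Metric.ball x m, ENNReal.ofReal (m ^ (τ - 2)) := by
          refine setLIntegral_mono' (hE.diff measurableSet_ball) fun y hy => ?_
          have hd : m ≤ ‖x - y‖ := by
            have := hy.2
            rw [Metric.mem_ball, not_lt, dist_eq_norm, norm_sub_rev] at this
            exact this
          have hmi : ‖x - y‖ₑ⁻¹ ≤ ENNReal.ofReal m⁻¹ := by
            rw [ENNReal.ofReal_inv_of_pos hm, ← ofReal_norm]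
            exact ENNReal.inv_le_inv.2 (ENNReal.ofReal_le_ofReal hd)
          refine (ENNReal.rpow_le_rpow hmi (by linarith)).trans ?_
          rw [ENNReal.ofReal_rpow_of_pos (by positivity), Real.inv_rpow hm.le,
            ← Real.rpow_neg hm.le, neg_sub]
      _ ≤ ENNReal.ofReal (m ^ (τ - 2)) * ENNReal.ofReal (m ^ 2) := by
          rw [setLIntegral_const]
          gcongr
          exact (measure_mono Set.sdiff_subset).trans hEm.le
      _ = ENNReal.ofReal (m ^ τ) := by
          rw [← ENNReal.ofReal_mul (by positivity), ← Real.rpow_natCast, ← Real.rpow_add hm]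
          norm_num
  rw [← lintegral_inter_add_sdiff _ _ (measurableSet_ball (x := x) (ε := m))]
  refine (add_le_add h1 h2).trans ?_
  rw [← ENNReal.ofReal_add (by positivity) (by positivity)]
  refine ENNReal.ofReal_le_ofReal (le_of_eq ?_)
  field_simp

/-- The truncated Riesz potential of order one, `∫_E f(y) / |x - y| dy`. -/
noncomputable def rieszPotential (E : Set Plane) (f : Plane → ℝ≥0∞) (x : Plane) : ℝ≥0∞ :=
  ∫⁻ y in E, f y * ‖x - y‖ₑ⁻¹

lemma measurable_inv_enorm_sub (x : Plane) : Measurable fun y : Plane => ‖x - y‖ₑ⁻¹ := by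
  fun_prop

/-- Splitting `f K = (f² K^{1/k})^{1/2} (K^{2-1/k})^{1/2}` and then
`f² K^{1/k} = (f²)^{1-1/k} (f² K)^{1/k}`, with `K(y) = 1/|x-y|`, and using Hölder's inequality
twice. -/
lemma rieszPotential_pow_le (x : Plane) {E : Set Plane} {f : Plane → ℝ≥0∞} (hf : Measurable f)
    {k : ℕ} (hk : 1 ≤ k) :
    rieszPotential E f x ^ (2 * k) ≤
      (∫⁻ y in E, f y ^ 2) ^ (k - 1) * (∫⁻ y in E, f y ^ 2 * ‖x - y‖ₑ⁻¹) *
        (∫⁻ y in E, (‖x - y‖ₑ⁻¹) ^ (2 - (k : ℝ)⁻¹)) ^ k := by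
  have hk0 : (0 : ℝ) < k := by exact_mod_cast hk
  have hki : (k : ℝ)⁻¹ ≤ 1 := inv_le_one_of_one_le₀ (by exact_mod_cast hk)
  have hki0 : 0 < (k : ℝ)⁻¹ := inv_pos.mpr hk0
  have hK := measurable_inv_enorm_sub x
  set K : Plane → ℝ≥0∞ := fun y => ‖x - y‖ₑ⁻¹ with hKdef
  have s1 : rieszPotential E f x ≤ (∫⁻ y in E, f y ^ 2 * K y ^ (k : ℝ)⁻¹) ^ (1 / 2 : ℝ) *
      (∫⁻ y in E, K y ^ (2 - (k : ℝ)⁻¹)) ^ (1 / 2 : ℝ) := by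
    refine le_trans (le_of_eq ?_) (ENNReal.lintegral_mul_norm_pow_le (p := 1 / 2) (q := 1 / 2)
      (by fun_prop) (by fun_prop) (by norm_num) (by norm_num) (by norm_num))
    refine lintegral_congr fun y => ?_
    rw [ENNReal.mul_rpow_of_nonneg _ _ (by norm_num), ← ENNReal.rpow_natCast, ← ENNReal.rpow_mul,
      ← ENNReal.rpow_mul, ← ENNReal.rpow_mul, mul_assoc,
      ← ENNReal.rpow_add_of_nonneg _ _ (by positivity) (by nlinarith)]
    rw [show ((2 : ℕ) : ℝ) * (1 / 2) = 1 by norm_num,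
      show (k : ℝ)⁻¹ * (1 / 2) + (2 - (k : ℝ)⁻¹) * (1 / 2) = 1 by ring, ENNReal.rpow_one,
      ENNReal.rpow_one]
  have s2 : ∫⁻ y in E, f y ^ 2 * K y ^ (k : ℝ)⁻¹ ≤ (∫⁻ y in E, f y ^ 2) ^ (1 - (k : ℝ)⁻¹) *
      (∫⁻ y in E, f y ^ 2 * K y) ^ (k : ℝ)⁻¹ := by
    refine le_trans (le_of_eq ?_) (ENNReal.lintegral_mul_norm_pow_le (p := 1 - (k : ℝ)⁻¹)
      (q := (k : ℝ)⁻¹) (by fun_prop) (by fun_prop) (by linarith) (by linarith) (by ring))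
    refine lintegral_congr fun y => ?_
    rw [ENNReal.mul_rpow_of_nonneg _ _ hki0.le, ← mul_assoc,
      ← ENNReal.rpow_add_of_nonneg _ _ (by linarith) hki0.le]
    simp
  have s3 : (rieszPotential E f x) ^ 2 ≤
      (∫⁻ y in E, f y ^ 2 * K y ^ (k : ℝ)⁻¹) * ∫⁻ y in E, K y ^ (2 - (k : ℝ)⁻¹) := by
    refine (pow_le_pow_left' s1 2).trans (le_of_eq ?_)
    rw [mul_pow, ← ENNReal.rpow_natCast, ← ENNReal.rpow_mul, ← ENNReal.rpow_natCast,
      ← ENNReal.rpow_mul]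
    norm_num
  rw [pow_mul]
  refine (pow_le_pow_left' s3 k).trans ?_
  rw [mul_pow]
  refine mul_le_mul' ((pow_le_pow_left' s2 k).trans (le_of_eq ?_)) le_rfl
  rw [mul_pow, ← ENNReal.rpow_natCast, ← ENNReal.rpow_mul, ← ENNReal.rpow_natCast (n := k),
    ← ENNReal.rpow_mul, inv_mul_cancel₀ hk0.ne', ENNReal.rpow_one, sub_mul,
    inv_mul_cancel₀ hk0.ne', one_mul, ← ENNReal.rpow_natCast, Nat.cast_sub hk, Nat.cast_one]

/-- The moments of a Riesz potential grow like `k ^ k` rather than `(k!)²`; this is what makes the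
square of the potential exponentially integrable. -/
lemma lintegral_rieszPotential_pow_le {E : Set Plane} (hE : MeasurableSet E)
    (hEfin : volume E ≠ ⊤) {f : Plane → ℝ≥0∞} (hf : Measurable f) {k : ℕ} (hk : 1 ≤ k) :
    ∫⁻ x in E, rieszPotential E f x ^ (2 * k) ≤
      (∫⁻ y in E, f y ^ 2) ^ k * volume E * (8 * (8 * k) ^ k) := by
  rcases eq_or_ne (volume E) 0 with hE0 | hE0
  · rw [setLIntegral_measure_zero _ _ hE0]; exact zero_le
  have hk0 : (0 : ℝ) < k := by exact_mod_cast hk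
  have hk1 : (1 : ℝ) ≤ k := by exact_mod_cast hk
  have hki : (k : ℝ)⁻¹ ≤ 1 := inv_le_one_of_one_le₀ hk1
  obtain ⟨m, hm, hEm⟩ : ∃ m : ℝ, 0 < m ∧ volume E = ENNReal.ofReal (m ^ 2) := by
    have : 0 < (volume E).toReal := ENNReal.toReal_pos hE0 hEfin
    exact ⟨√(volume E).toReal, by positivity, by
      rw [Real.sq_sqrt this.le, ENNReal.ofReal_toReal hEfin]⟩
  have hpi : Real.pi < 3.15 := Real.pi_lt_d2
  have hB : ∀ x : Plane, (∫⁻ y in E, (‖x - y‖ₑ⁻¹) ^ (2 - (k : ℝ)⁻¹)) ^ k ≤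
      ENNReal.ofReal m * (8 * k) ^ k := by
    intro x
    refine (pow_le_pow_left' (setLIntegral_inv_enorm_rpow_le x (inv_pos.mpr hk0)
      (by linarith) hm hE hEm) k).trans ?_
    have h8 : (2 * Real.pi / (k : ℝ)⁻¹ + 1) * m ^ (k : ℝ)⁻¹ ≤ m ^ (k : ℝ)⁻¹ * (8 * k) := by
      rw [mul_comm, div_inv_eq_mul]
      gcongr
      nlinarith
    refine (pow_le_pow_left' (ENNReal.ofReal_le_ofReal h8) k).trans (le_of_eq ?_)
    rw [ENNReal.ofReal_mul (by positivity), mul_pow, ← ENNReal.ofReal_pow (by positivity),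
      ← Real.rpow_natCast, ← Real.rpow_mul hm.le, inv_mul_cancel₀ hk0.ne', Real.rpow_one]
    congr 2
    rw [ENNReal.ofReal_mul (by norm_num)]
    simp
  have hA : ∫⁻ x in E, ∫⁻ y in E, f y ^ 2 * ‖x - y‖ₑ⁻¹ ≤
      (∫⁻ y in E, f y ^ 2) * ENNReal.ofReal (8 * m) := by
    rw [lintegral_lintegral_swap (by fun_prop)]
    rw [← lintegral_mul_const _ (by fun_prop)]
    refine lintegral_mono fun y => ?_
    dsimp only
    rw [lintegral_const_mul _ (by fun_prop)]
    gcongr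
    have := setLIntegral_inv_enorm_rpow_le y one_pos one_le_two hm hE hEm
    norm_num at this
    simp_rw [← edist_eq_enorm_sub, edist_comm _ y, edist_eq_enorm_sub]
    refine this.trans (ENNReal.ofReal_le_ofReal ?_)
    gcongr
    linarith
  set F := ∫⁻ y in E, f y ^ 2
  have hm2 : Measurable fun x => ∫⁻ y in E, f y ^ 2 * ‖x - y‖ₑ⁻¹ :=
    Measurable.lintegral_prod_right' (f := fun p : Plane × Plane => f p.2 ^ 2 * ‖p.1 - p.2‖ₑ⁻¹)
      (by fun_prop)
  calc ∫⁻ x in E, rieszPotential E f x ^ (2 * k)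
      ≤ ∫⁻ x in E, (F ^ (k - 1) * (ENNReal.ofReal m * (8 * k) ^ k)) *
          ∫⁻ y in E, f y ^ 2 * ‖x - y‖ₑ⁻¹ := by
        refine lintegral_mono fun x => (rieszPotential_pow_le x hf hk).trans ?_
        rw [mul_right_comm]
        gcongr
        exact hB x
    _ ≤ (F ^ (k - 1) * (ENNReal.ofReal m * (8 * k) ^ k)) * (F * ENNReal.ofReal (8 * m)) := by
        rw [lintegral_const_mul _ hm2]
        gcongr
    _ = F ^ k * volume E * (8 * (8 * k) ^ k) := by
        obtain ⟨j, rfl⟩ : ∃ j, k = j + 1 := ⟨k - 1, by omega⟩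
        rw [hEm, ENNReal.ofReal_pow hm.le, ENNReal.ofReal_mul (by norm_num), ENNReal.ofReal_ofNat,
          Nat.add_sub_cancel]
        ring

lemma measurable_rieszPotential (E : Set Plane) {f : Plane → ℝ≥0∞} (hf : Measurable f) :
    Measurable (rieszPotential E f) :=
  Measurable.lintegral_prod_right' (f := fun p : Plane × Plane => f p.2 * ‖p.1 - p.2‖ₑ⁻¹)
    (by fun_prop)

/-! ### Exponential integrability of Riesz potentials -/

lemma hasSum_youngA {t : ℝ} (ht : 0 ≤ t) :
    HasSum (fun k : ℕ => t ^ (k + 2) / (k + 2).factorial) (youngA t) := by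
  rw [hasSum_nat_add_iff (f := fun k : ℕ => t ^ k / k.factorial) 2]
  have h := NormedSpace.expSeries_div_hasSum_exp t
  rw [← Real.exp_eq_exp_ℝ] at h
  convert! h using 1
  rw [youngA, abs_of_nonneg ht]
  simp [Finset.sum_range_succ]

lemma natCast_pow_self_le (k : ℕ) : (k : ℝ) ^ k ≤ 3 ^ k * k.factorial := by
  have h := Real.pow_div_factorial_le_exp (k : ℝ) k.cast_nonneg k
  rw [div_le_iff₀ (by positivity)] at h
  refine h.trans ?_
  gcongr
  rw [← mul_one (k : ℝ), Real.exp_nat_mul]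
  exact pow_le_pow_left₀ (by positivity) Real.exp_one_lt_three.le k

/-- Exponential integrability of functions dominated by a Riesz potential, obtained by summing the
moment bounds. -/
lemma lintegral_youngA_le {E : Set Plane} (hE : MeasurableSet E) (hEfin : volume E ≠ ⊤)
    {f : Plane → ℝ≥0∞} (hf : Measurable f) {w : Plane → ℂ}
    (hw : ∀ᵐ x ∂volume.restrict E, ‖w x‖ₑ ≤ 12 * rieszPotential E f x) {D : ℝ} (hD : 0 ≤ D)
    (hfD : ∫⁻ y in E, f y ^ 2 ≤ ENNReal.ofReal D) :
    ∫⁻ x in E, ENNReal.ofReal (youngA (1 / 13824 * ‖w x‖ ^ 2 / D)) ≤ volume E := by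
  rcases hD.eq_or_lt with rfl | hD
  -- division by zero gives `𝓐(0) = 0`, the convention for a vanishing gradient
  · simp [youngA]
  -- `13824 = 4 * 3 * 8 * 144` makes the `k`-th term of the series at most `8 / 4 ^ k` times the area.
  set c : ℕ → ℝ := fun j => (1 / (96 * D)) ^ j / j.factorial with hc
  have hcnn : ∀ j, 0 ≤ c j := fun j => by positivity
  have hpt : ∀ᵐ x ∂volume.restrict E, ENNReal.ofReal (youngA (1 / 13824 * ‖w x‖ ^ 2 / D)) ≤
      ∑' k : ℕ, ENNReal.ofReal (c (k + 2)) * rieszPotential E f x ^ (2 * (k + 2)) := by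
    filter_upwards [hw] with x hx
    have ht : 0 ≤ 1 / 13824 * ‖w x‖ ^ 2 / D := by positivity
    rw [← (hasSum_youngA ht).tsum_eq, ENNReal.ofReal_tsum_of_nonneg (fun n => by positivity)
      (hasSum_youngA ht).summable]
    refine ENNReal.tsum_le_tsum fun k => ?_
    have e : (1 / 13824 * ‖w x‖ ^ 2 / D) ^ (k + 2) / (k + 2).factorial
        = c (k + 2) * (‖w x‖ / 12) ^ (2 * (k + 2)) := by
      have h : 1 / 13824 * ‖w x‖ ^ 2 / D = 1 / (96 * D) * (‖w x‖ / 12) ^ 2 := by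
        field_simp
        ring
      rw [h, mul_pow, pow_mul]
      ring
    rw [e, ENNReal.ofReal_mul (hcnn _), ENNReal.ofReal_pow (by positivity)]
    gcongr
    rw [ENNReal.ofReal_div_of_pos (by norm_num), ofReal_norm, ENNReal.ofReal_ofNat]
    exact ENNReal.div_le_of_le_mul' hx
  have hterm : ∀ j : ℕ, 1 ≤ j → ENNReal.ofReal (c j) * ∫⁻ x in E, rieszPotential E f x ^ (2 * j)
      ≤ ENNReal.ofReal (8 * (1 / 4) ^ j) * volume E := by
    intro j hj
    have h1 := lintegral_rieszPotential_pow_le hE hEfin hf hj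
    have h2 : (∫⁻ y in E, f y ^ 2) ^ j ≤ ENNReal.ofReal (D ^ j) := by
      rw [ENNReal.ofReal_pow hD.le]
      exact pow_le_pow_left' hfD j
    have h3 : (8 * (8 * j) ^ j : ℝ≥0∞) = ENNReal.ofReal (8 * (8 * j) ^ j) := by
      rw [ENNReal.ofReal_mul (by norm_num), ENNReal.ofReal_pow (by positivity),
        ENNReal.ofReal_mul (by norm_num)]
      simp
    calc _ ≤ ENNReal.ofReal (c j) * (ENNReal.ofReal (D ^ j) * volume E *
          ENNReal.ofReal (8 * (8 * j) ^ j)) := by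
          gcongr
          refine h1.trans ?_
          rw [← h3]
          gcongr
      _ = ENNReal.ofReal (c j * (D ^ j * (8 * (8 * j) ^ j))) * volume E := by
          rw [ENNReal.ofReal_mul (hcnn _), ENNReal.ofReal_mul (p := D ^ j) (by positivity)]
          ring
      _ ≤ _ := by
          refine mul_le_mul' (ENNReal.ofReal_le_ofReal ?_) le_rfl
          have h5 := natCast_pow_self_le j
          have e : c j * (D ^ j * (8 * (8 * j) ^ j))
              = 8 * ((1 / 12) ^ j * ((j : ℝ) ^ j / j.factorial)) := by
            rw [hc]
            simp only [one_div, inv_pow, mul_pow]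
            rw [show (96 : ℝ) = 12 * 8 by norm_num, mul_pow]
            field_simp
          rw [e]
          gcongr
          calc (1 / 12 : ℝ) ^ j * ((j : ℝ) ^ j / j.factorial) ≤ (1 / 12 : ℝ) ^ j * 3 ^ j := by
                gcongr
                rwa [div_le_iff₀ (by positivity)]
            _ = (1 / 4) ^ j := by rw [← mul_pow]; norm_num
  have hgeo : HasSum (fun k : ℕ => (8 : ℝ) * (1 / 4) ^ (k + 2)) (2 / 3) := by
    have h := (hasSum_geometric_of_lt_one (r := 1 / 4) (by norm_num) (by norm_num)).mul_left
      (1 / 2 : ℝ)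
    convert! h using 1
    · ext k; rw [pow_add]; ring
    · norm_num
  have hVm := measurable_rieszPotential E hf
  calc _ ≤ ∫⁻ x in E, ∑' k : ℕ, ENNReal.ofReal (c (k + 2)) *
          rieszPotential E f x ^ (2 * (k + 2)) := lintegral_mono_ae hpt
    _ = ∑' k : ℕ, ENNReal.ofReal (c (k + 2)) *
          ∫⁻ x in E, rieszPotential E f x ^ (2 * (k + 2)) := by
        rw [lintegral_tsum fun k => by fun_prop]
        congr 1 with k
        rw [lintegral_const_mul _ (by fun_prop)]
    _ ≤ ∑' k : ℕ, ENNReal.ofReal (8 * (1 / 4) ^ (k + 2)) * volume E :=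
        ENNReal.tsum_le_tsum fun k => hterm _ (by omega)
    _ = ENNReal.ofReal (2 / 3) * volume E := by
        rw [ENNReal.tsum_mul_right, ← ENNReal.ofReal_tsum_of_nonneg (fun n => by positivity)
          hgeo.summable, hgeo.tsum_eq]
    _ ≤ 1 * volume E := by
        gcongr
        rw [ENNReal.ofReal_le_one]
        norm_num
    _ = volume E := one_mul _

/-! ### Smooth approximations of the indicator of an interval -/

/-- A smooth bump on the line, equal to `1` on `[-(1 - 1/(n+2)), 1 - 1/(n+2)]` and supported in
`[-(1 - 1/(n+3)), 1 - 1/(n+3)]`. As `n → ∞` these tend to the indicator of `(-1, 1)`. -/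
noncomputable def unitBump (n : ℕ) : ContDiffBump (0 : ℝ) where
  rIn := 1 - 1 / (n + 2)
  rOut := 1 - 1 / (n + 3)
  rIn_pos := by
    have : (1 : ℝ) / (n + 2) < 1 := by
      rw [div_lt_one (by positivity)]; linarith [(n.cast_nonneg : (0 : ℝ) ≤ n)]
    linarith
  rIn_lt_rOut := by
    have : (1 : ℝ) / (n + 3) < 1 / (n + 2) := by gcongr; norm_num
    linarith

lemma unitBump_eq_zero {n : ℕ} {s : ℝ} (hs : 1 - 1 / (n + 3) ≤ |s|) : unitBump n s = 0 :=
  (unitBump n).zero_of_le_dist (by rwa [Real.dist_eq, sub_zero])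

lemma tendsto_unitBump (s : ℝ) :
    Filter.Tendsto (fun n => unitBump n s) Filter.atTop
      (nhds ((Set.Ioo (-1 : ℝ) 1).indicator 1 s)) := by
  by_cases hs : s ∈ Set.Ioo (-1 : ℝ) 1
  · rw [Set.indicator_of_mem hs]
    refine tendsto_const_nhds.congr' ?_
    have h : Filter.Tendsto (fun n : ℕ => 1 - 1 / ((n : ℝ) + 1)) Filter.atTop (nhds (1 - 0)) :=
      tendsto_const_nhds.sub tendsto_one_div_add_atTop_nhds_zero_nat
    rw [sub_zero] at h
    have h' := (Filter.tendsto_add_atTop_iff_nat 1).mpr h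
    filter_upwards [h'.eventually (lt_mem_nhds (abs_lt.mpr hs))] with n hn
    refine ((unitBump n).one_of_mem_closedBall ?_).symm
    rw [mem_closedBall_zero_iff, Real.norm_eq_abs]
    refine hn.le.trans (le_of_eq ?_)
    change _ = 1 - 1 / ((n : ℝ) + 2)
    push_cast
    rw [add_assoc]; norm_num
  · rw [Set.indicator_of_notMem hs]
    refine tendsto_const_nhds.congr fun n => (unitBump_eq_zero ?_).symm
    have h1 : 1 ≤ |s| := by
      by_contra! h
      exact hs (abs_lt.mp h)
    have : (0 : ℝ) < 1 / (n + 3) := by positivity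
    linarith

/-- Half the primitive of `unitBump n`: a smooth approximation of the clamped affine function
that climbs from `0` at `-1` to `1` at `1`. -/
noncomputable def unitRamp (n : ℕ) (s : ℝ) : ℝ := (1 / 2) * ∫ t in (-1 : ℝ)..s, unitBump n t

lemma hasDerivAt_unitRamp (n : ℕ) (s : ℝ) : HasDerivAt (unitRamp n) ((1 / 2) * unitBump n s) s :=
  ((unitBump n).continuous.integral_hasStrictDerivAt (-1) s).hasDerivAt.const_mul _

lemma contDiff_unitRamp (n : ℕ) : ContDiff ℝ ∞ (unitRamp n) := by
  rw [contDiff_infty_iff_deriv]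
  refine ⟨fun s => (hasDerivAt_unitRamp n s).differentiableAt, ?_⟩
  rw [funext fun s => (hasDerivAt_unitRamp n s).deriv]
  exact contDiff_const.mul (unitBump n).contDiff

lemma unitRamp_of_le {n : ℕ} {s : ℝ} (hs : s ≤ -(1 - 1 / (n + 3))) : unitRamp n s = 0 := by
  have : ∫ t in (-1 : ℝ)..s, unitBump n t = ∫ t in (-1 : ℝ)..s, (0 : ℝ) := by
    refine intervalIntegral.integral_congr fun t ht => unitBump_eq_zero ?_
    have h0 : (0 : ℝ) < 1 / (n + 3) := by positivity
    have : t ≤ -(1 - 1 / (n + 3)) := ht.2.trans (max_le (by linarith) hs)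
    exact (by linarith : _ ≤ -t).trans (neg_le_abs t)
  simp [unitRamp, this]

lemma unitRamp_of_ge {n : ℕ} {s : ℝ} (hs : 1 - 1 / (n + 3) ≤ s) : unitRamp n s = unitRamp n 1 := by
  have : ∫ t in (1 : ℝ)..s, unitBump n t = ∫ t in (1 : ℝ)..s, (0 : ℝ) := by
    refine intervalIntegral.integral_congr fun t ht => unitBump_eq_zero ?_
    have h0 : (0 : ℝ) < 1 / (n + 3) := by positivity
    have : 1 - 1 / (n + 3) ≤ t := le_trans (le_min (by linarith) hs) ht.1
    exact this.trans (le_abs_self t)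
  have hi : ∀ a b, IntervalIntegrable (unitBump n) volume a b :=
    fun a b => (unitBump n).continuous.intervalIntegrable a b
  rw [unitRamp, ← intervalIntegral.integral_add_adjacent_intervals (hi (-1) 1) (hi 1 s), this]
  simp [unitRamp]

lemma monotone_unitRamp (n : ℕ) : Monotone (unitRamp n) :=
  monotone_of_hasDerivAt_nonneg (hasDerivAt_unitRamp n)
    fun s => mul_nonneg (by norm_num) (unitBump n).nonneg

lemma unitRamp_nonneg (n : ℕ) (s : ℝ) : 0 ≤ unitRamp n s := by
  have h0 : (0 : ℝ) < 1 / (n + 3) := by positivity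
  have := monotone_unitRamp n (min_le_left s (-1))
  rwa [unitRamp_of_le ((min_le_right s (-1)).trans (by linarith))] at this

lemma unitRamp_le_one (n : ℕ) (s : ℝ) : unitRamp n s ≤ 1 := by
  have h0 : (0 : ℝ) < 1 / (n + 3) := by positivity
  have h1 := monotone_unitRamp n (le_max_left s 1)
  rw [unitRamp_of_ge (le_trans (by linarith) (le_max_right s 1))] at h1
  refine h1.trans ?_
  have : ∫ t in (-1 : ℝ)..1, unitBump n t ≤ ∫ t in (-1 : ℝ)..1, (1 : ℝ) :=
    intervalIntegral.integral_mono_on (by norm_num)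
      ((unitBump n).continuous.intervalIntegrable _ _) (by simp) fun t _ => (unitBump n).le_one
  norm_num at this
  rw [unitRamp]
  linarith

/-! ### Averages over nested rectangles and cubes -/

lemma norm_le_of_abs_le {z : Plane} {r : ℝ} (hz : ∀ i, |z i| ≤ r) : ‖z‖ ≤ 2 * r := by
  have hr : 0 ≤ r := (abs_nonneg _).trans (hz 0)
  refine abs_le_of_sq_le_sq' ?_ (by positivity) |>.2
  rw [EuclideanSpace.norm_sq_eq, Fin.sum_univ_two, Real.norm_eq_abs, Real.norm_eq_abs]
  have h0 := pow_le_pow_left₀ (abs_nonneg _) (hz 0) 2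
  have h1 := pow_le_pow_left₀ (abs_nonneg _) (hz 1) 2
  nlinarith

/-- The open rectangle with centre coordinates `c`, `d` and half-widths `r`, `s` in the directions
`i` and `k`. -/
def openRect (i k : Fin 2) (c r d s : ℝ) : Set Plane := {x | |x i - c| < r ∧ |x k - d| < s}

lemma isOpen_openRect (i k : Fin 2) (c r d s : ℝ) : IsOpen (openRect i k c r d s) :=
  (isOpen_lt (f := fun x : Plane => |x i - c|) (by fun_prop) continuous_const).and
    (isOpen_lt (f := fun x : Plane => |x k - d|) (by fun_prop) continuous_const)

lemma isCompact_closedRect {i k : Fin 2} (hik : i ≠ k) (c r d s : ℝ) :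
    IsCompact {x : Plane | |x i - c| ≤ r ∧ |x k - d| ≤ s} := by
  refine Metric.isCompact_of_isClosed_isBounded
    ((isClosed_le (f := fun x : Plane => |x i - c|) (by fun_prop) continuous_const).and
      (isClosed_le (f := fun x : Plane => |x k - d|) (by fun_prop) continuous_const)) ?_
  refine isBounded_iff_forall_norm_le.mpr ⟨2 * (max (|c| + r) (|d| + s)), fun x hx => ?_⟩
  refine norm_le_of_abs_le fun j => ?_
  have hj : j = i ∨ j = k := by omega
  rcases hj with rfl | rfl
  · refine le_trans ?_ (le_max_left _ _)
    have := abs_sub_abs_le_abs_sub (x j) c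
    linarith [hx.1]
  · refine le_trans ?_ (le_max_right _ _)
    have := abs_sub_abs_le_abs_sub (x j) d
    linarith [hx.2]

/-- The profile in the first direction of the test function that compares the averages over
`(c' - r', c' + r')` and `(c - r, c + r)`: the difference of the (smoothed) distribution functions
of the two uniform measures. -/
noncomputable def rampDiff (n : ℕ) (c r c' r' t : ℝ) : ℝ :=
  unitRamp n ((t - c') / r') - unitRamp n ((t - c) / r)

lemma contDiff_rampDiff (n : ℕ) (c r c' r' : ℝ) : ContDiff ℝ ∞ (rampDiff n c r c' r') :=
  ((contDiff_unitRamp n).comp ((contDiff_id.sub contDiff_const).div_const _)).sub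
    ((contDiff_unitRamp n).comp ((contDiff_id.sub contDiff_const).div_const _))

lemma hasDerivAt_rampDiff (n : ℕ) (c r c' r' t : ℝ) :
    HasDerivAt (rampDiff n c r c' r')
      (unitBump n ((t - c') / r') / (2 * r') - unitBump n ((t - c) / r) / (2 * r)) t := by
  have h : ∀ c r : ℝ, HasDerivAt (fun t => unitRamp n ((t - c) / r))
      (unitBump n ((t - c) / r) / (2 * r)) t := fun c r => by
    have h1 : HasDerivAt (fun t : ℝ => (t - c) / r) (1 / r) t :=
      ((hasDerivAt_id t).sub_const c).div_const r
    convert! (hasDerivAt_unitRamp n ((t - c) / r)).comp t h1 using 1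
    ring
  exact (h c' r').sub (h c r)

lemma abs_rampDiff_le_one (n : ℕ) (c r c' r' t : ℝ) : |rampDiff n c r c' r' t| ≤ 1 := by
  have h1 := unitRamp_nonneg n ((t - c') / r')
  have h2 := unitRamp_le_one n ((t - c') / r')
  have h3 := unitRamp_nonneg n ((t - c) / r)
  have h4 := unitRamp_le_one n ((t - c) / r)
  rw [rampDiff, abs_le]
  constructor <;> linarith

lemma rampDiff_eq_zero {n : ℕ} {c r c' r' t : ℝ} (hr' : 0 < r') (h1 : c - r ≤ c' - r')
    (h2 : c' + r' ≤ c + r) (ht : r - r' / (n + 3) < |t - c|) : rampDiff n c r c' r' t = 0 := by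
  have hrr : r' ≤ r := by linarith
  have hr : 0 < r := by linarith
  have hδ : (0 : ℝ) < 1 / (n + 3) := by positivity
  have hδr : r' * (1 / (n + 3)) ≤ r * (1 / (n + 3)) := by gcongr
  have e : r' / ((n : ℝ) + 3) = r' * (1 / (n + 3)) := by ring
  rw [e] at ht
  rw [rampDiff]
  rcases lt_abs.mp ht with ht | ht
  · rw [unitRamp_of_ge (s := (t - c') / r'), unitRamp_of_ge (s := (t - c) / r), sub_self]
    · rw [le_div_iff₀ hr]; nlinarith
    · rw [le_div_iff₀ hr']; nlinarith
  · rw [unitRamp_of_le (s := (t - c') / r'), unitRamp_of_le (s := (t - c) / r), sub_self]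
    · rw [div_le_iff₀ hr]; nlinarith
    · rw [div_le_iff₀ hr']; nlinarith

lemma unitBump_div_eq_zero {n : ℕ} {d s t : ℝ} (hs : 0 < s) (ht : s - s / (n + 3) < |t - d|) :
    unitBump n ((t - d) / s) = 0 := by
  refine unitBump_eq_zero ?_
  rw [abs_div, abs_of_pos hs, le_div_iff₀ hs]
  have e : s / ((n : ℝ) + 3) = s * (1 / (n + 3)) := by ring
  nlinarith

/-- The test function comparing the averages over two rectangles that differ in direction `i`. -/
noncomputable def rectTest (n : ℕ) (i k : Fin 2) (c r c' r' d s : ℝ) (x : Plane) : ℂ :=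
  ((rampDiff n c r c' r' (x i) * unitBump n ((x k - d) / s) : ℝ) : ℂ)

lemma rectTest_eq_zero {n : ℕ} {i k : Fin 2} {c r c' r' d s : ℝ} (hr' : 0 < r') (hs : 0 < s)
    (h1 : c - r ≤ c' - r') (h2 : c' + r' ≤ c + r) {x : Plane}
    (hx : ¬ (|x i - c| ≤ r - r' / (n + 3) ∧ |x k - d| ≤ s - s / (n + 3))) :
    rectTest n i k c r c' r' d s x = 0 := by
  rw [not_and_or, not_le, not_le] at hx
  rcases hx with hx | hx
  · simp [rectTest, rampDiff_eq_zero hr' h1 h2 hx]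
  · simp [rectTest, unitBump_div_eq_zero hs hx]

lemma contDiff_rectTest (n : ℕ) (i k : Fin 2) (c r c' r' d s : ℝ) :
    ContDiff ℝ ∞ (rectTest n i k c r c' r' d s) := by
  have hi : ∀ j : Fin 2, ContDiff ℝ ∞ fun x : Plane => x j := fun j => by fun_prop
  exact Complex.ofRealCLM.contDiff.comp (((contDiff_rampDiff n c r c' r').comp (hi i)).mul
    ((unitBump n).contDiff.comp (((hi k).sub contDiff_const).div_const s)))

lemma partialDeriv_rectTest (n : ℕ) {i k : Fin 2} (hik : i ≠ k) (c r c' r' d s : ℝ) (x : Plane) :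
    partialDeriv i (rectTest n i k c r c' r' d s) x =
      (((unitBump n ((x i - c') / r') / (2 * r') - unitBump n ((x i - c) / r) / (2 * r)) *
        unitBump n ((x k - d) / s) : ℝ) : ℂ) := by
  have hdiff : DifferentiableAt ℝ (rectTest n i k c r c' r' d s) x :=
    (contDiff_rectTest n i k c r c' r' d s).differentiable (by simp) x
  rw [partialDeriv, ← hdiff.lineDeriv_eq_fderiv]
  refine HasDerivAt.deriv ?_
  have e : (fun t : ℝ => rectTest n i k c r c' r' d s (x + t • EuclideanSpace.single i 1))
      = fun t : ℝ => ((rampDiff n c r c' r' (x i + t) * unitBump n ((x k - d) / s) : ℝ) : ℂ) := by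
    ext t
    simp [rectTest, hik.symm]
  rw [e]
  refine HasDerivAt.ofReal_comp (HasDerivAt.mul_const ?_ _)
  have := hasDerivAt_rampDiff n c r c' r' (x i + 0)
  rw [add_zero] at this
  exact HasDerivAt.comp_const_add (x i) 0 (by rwa [add_zero])

lemma isTestFunction_rectTest (n : ℕ) {i k : Fin 2} (hik : i ≠ k) {c r c' r' d s : ℝ}
    (hr' : 0 < r') (hs : 0 < s) (h1 : c - r ≤ c' - r') (h2 : c' + r' ≤ c + r) {Q : Set Plane}
    (hQ : openRect i k c r d s ⊆ Q) : IsTestFunction Q (rectTest n i k c r c' r' d s) := by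
  have hK := isCompact_closedRect hik c (r - r' / (n + 3)) d (s - s / (n + 3))
  have hsupp : tsupport (rectTest n i k c r c' r' d s) ⊆
      {x : Plane | |x i - c| ≤ r - r' / (n + 3) ∧ |x k - d| ≤ s - s / (n + 3)} := by
    refine closure_minimal (fun x hx => ?_) hK.isClosed
    by_contra h
    exact hx (rectTest_eq_zero hr' hs h1 h2 h)
  refine ⟨contDiff_rectTest n i k c r c' r' d s, hK.of_isClosed_subset (isClosed_tsupport _) hsupp,
    (hsupp.trans fun x hx => ?_).trans hQ⟩
  have e1 : 0 < r' / ((n : ℝ) + 3) := by positivity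
  have e2 : 0 < s / ((n : ℝ) + 3) := by positivity
  exact ⟨hx.1.trans_lt (by linarith), hx.2.trans_lt (by linarith)⟩

lemma norm_rectTest_le (n : ℕ) {i k : Fin 2} {c r c' r' d s : ℝ}
    (hr' : 0 < r') (hs : 0 < s) (h1 : c - r ≤ c' - r') (h2 : c' + r' ≤ c + r) (x : Plane) :
    ‖rectTest n i k c r c' r' d s x‖ ≤ (openRect i k c r d s).indicator (fun _ => 1) x := by
  by_cases hx : x ∈ openRect i k c r d s
  · rw [Set.indicator_of_mem hx, rectTest, Complex.norm_real, norm_mul]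
    refine mul_le_one₀ (abs_rampDiff_le_one _ _ _ _ _ _) (norm_nonneg _) ?_
    rw [Real.norm_of_nonneg (unitBump n).nonneg]
    exact (unitBump n).le_one
  · rw [Set.indicator_of_notMem hx, rectTest_eq_zero hr' hs h1 h2, norm_zero]
    have e1 : 0 < r' / ((n : ℝ) + 3) := by positivity
    have e2 : 0 < s / ((n : ℝ) + 3) := by positivity
    exact fun h => hx ⟨h.1.trans_lt (by linarith), h.2.trans_lt (by linarith)⟩

lemma tendsto_unitBump_div {c r : ℝ} (hr : 0 < r) (t : ℝ) :
    Filter.Tendsto (fun n => unitBump n ((t - c) / r)) Filter.atTop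
      (nhds ({t : ℝ | |t - c| < r}.indicator 1 t)) := by
  convert! tendsto_unitBump ((t - c) / r) using 2
  have : (t - c) / r ∈ Set.Ioo (-1 : ℝ) 1 ↔ |t - c| < r := by
    rw [Set.mem_Ioo, ← abs_lt, abs_div, abs_of_pos hr, div_lt_one hr]
  by_cases h : |t - c| < r
  · rw [Set.indicator_of_mem (by exact h), Set.indicator_of_mem (this.mpr h)]; rfl
  · rw [Set.indicator_of_notMem (by exact h), Set.indicator_of_notMem (this.not.mpr h)]

/-- Shrinking a rectangle in one direction changes the average of `u` by at most the integral of
`|∇u|` over the rectangle, divided by its width in the other direction. -/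
lemma norm_average_sub_average_le {Q : Set Plane} {u : Plane → ℂ}
    {g : Plane → EuclideanSpace ℂ (Fin 2)} (hu : IntegrableOn u Q) (hg : IntegrableOn g Q)
    (hug : ∀ φ : Plane → ℂ, IsTestFunction Q φ → ∀ i : Fin 2,
      ∫ x in Q, u x * partialDeriv i φ x = -∫ x in Q, g x i * φ x)
    {i k : Fin 2} (hik : i ≠ k) {c r c' r' d s : ℝ}
    (hr' : 0 < r') (hs : 0 < s) (h1 : c - r ≤ c' - r') (h2 : c' + r' ≤ c + r)
    (hsub : openRect i k c r d s ⊆ Q) :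
    ‖(4 * r' * s)⁻¹ • (∫ x in openRect i k c' r' d s, u x) -
        (4 * r * s)⁻¹ • ∫ x in openRect i k c r d s, u x‖ ≤
      (2 * s)⁻¹ * ∫ x in openRect i k c r d s, ‖g x‖ := by
  have hr : 0 < r := by linarith
  have hsub' : openRect i k c' r' d s ⊆ Q := fun x hx => hsub ⟨by
    have := abs_lt.mp hx.1
    exact abs_lt.mpr ⟨by linarith, by linarith⟩, hx.2⟩
  have hmR := (isOpen_openRect i k c r d s).measurableSet
  have hmR' := (isOpen_openRect i k c' r' d s).measurableSet
  -- the derivatives of the test functions converge to a combination of two indicators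
  have hlim : Filter.Tendsto (fun n => ∫ x in Q, u x *
      partialDeriv i (rectTest n i k c r c' r' d s) x) Filter.atTop
      (nhds (∫ x in Q, ((2 * r')⁻¹ • (openRect i k c' r' d s).indicator u x -
        (2 * r)⁻¹ • (openRect i k c r d s).indicator u x))) := by
    refine tendsto_integral_of_dominated_convergence
      (fun x => ‖u x‖ * ((2 * r')⁻¹ + (2 * r)⁻¹)) (fun n => ?_) (hu.norm.mul_const _) (fun n => ?_) ?_
    · have hc : Continuous fun x => partialDeriv i (rectTest n i k c r c' r' d s) x := by
        simp_rw [partialDeriv_rectTest n hik]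
        have := (unitBump n).continuous
        fun_prop
      exact hu.aestronglyMeasurable.mul hc.aestronglyMeasurable
    · refine Filter.Eventually.of_forall fun x => ?_
      rw [norm_mul, partialDeriv_rectTest n hik, Complex.norm_real, norm_mul]
      gcongr
      rw [← mul_one ((2 * r')⁻¹ + (2 * r)⁻¹)]
      have hb0 : ∀ t, 0 ≤ unitBump n t := fun t => (unitBump n).nonneg
      have hb1 : ∀ t, unitBump n t ≤ 1 := fun t => (unitBump n).le_one
      gcongr
      · refine (norm_sub_le _ _).trans (add_le_add ?_ ?_)
        · rw [Real.norm_of_nonneg (div_nonneg (hb0 _) (by positivity)), div_eq_mul_inv]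
          exact mul_le_of_le_one_left (by positivity) (hb1 _)
        · rw [Real.norm_of_nonneg (div_nonneg (hb0 _) (by positivity)), div_eq_mul_inv]
          exact mul_le_of_le_one_left (by positivity) (hb1 _)
      · rw [Real.norm_of_nonneg (hb0 _)]; exact hb1 _
    · refine Filter.Eventually.of_forall fun x => ?_
      simp_rw [partialDeriv_rectTest _ hik]
      have hR : Filter.Tendsto (fun n => u x * (((unitBump n ((x i - c') / r') / (2 * r') -
          unitBump n ((x i - c) / r) / (2 * r)) * unitBump n ((x k - d) / s) : ℝ) : ℂ))
          Filter.atTop (nhds (u x * ((({t : ℝ | |t - c'| < r'}.indicator 1 (x i) / (2 * r') -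
            {t : ℝ | |t - c| < r}.indicator 1 (x i) / (2 * r)) *
            {t : ℝ | |t - d| < s}.indicator 1 (x k) : ℝ) : ℂ))) :=
        (Complex.continuous_ofReal.continuousAt.tendsto.comp
          ((((tendsto_unitBump_div hr' _).div_const _).sub
            ((tendsto_unitBump_div hr _).div_const _)).mul
              (tendsto_unitBump_div hs _))).const_mul _
      convert! hR using 2
      simp only [Set.indicator, openRect, Set.mem_ofPred_eq, Pi.one_apply, Complex.real_smul]
      by_cases p1 : |x i - c'| < r' <;> by_cases p2 : |x i - c| < r <;>
        by_cases p3 : |x k - d| < s <;> simp [p1, p2, p3] <;> ring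
  have hval : ∫ x in Q, ((2 * r')⁻¹ • (openRect i k c' r' d s).indicator u x -
        (2 * r)⁻¹ • (openRect i k c r d s).indicator u x) =
      (2 * r')⁻¹ • (∫ x in openRect i k c' r' d s, u x) -
        (2 * r)⁻¹ • ∫ x in openRect i k c r d s, u x := by
    rw [integral_sub, integral_smul, integral_smul, setIntegral_indicator hmR',
      setIntegral_indicator hmR, Set.inter_eq_right.mpr hsub, Set.inter_eq_right.mpr hsub']
    · exact (hu.indicator hmR').fun_smul _
    · exact (hu.indicator hmR).fun_smul _
  rw [hval] at hlim
  have hbound : ∀ n, ‖∫ x in Q, u x * partialDeriv i (rectTest n i k c r c' r' d s) x‖ ≤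
      ∫ x in openRect i k c r d s, ‖g x‖ := by
    intro n
    rw [hug _ (isTestFunction_rectTest n hik hr' hs h1 h2 hsub) i, norm_neg]
    refine (norm_integral_le_integral_norm _).trans ?_
    have e : ∫ x in openRect i k c r d s, ‖g x‖ =
        ∫ x in Q, (openRect i k c r d s).indicator (fun x => ‖g x‖) x := by
      rw [setIntegral_indicator hmR, Set.inter_eq_right.mpr hsub]
    rw [e]
    refine integral_mono_of_nonneg (Filter.Eventually.of_forall fun x => norm_nonneg _)
      (hg.norm.indicator hmR) (Filter.Eventually.of_forall fun x => ?_)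
    have hx := norm_rectTest_le n (i := i) (k := k) hr' hs h1 h2 x (d := d)
    have hgi : ‖g x i‖ ≤ ‖g x‖ := PiLp.norm_apply_le (g x) i
    dsimp only
    rw [norm_mul]
    by_cases hxR : x ∈ openRect i k c r d s
    · rw [Set.indicator_of_mem hxR] at hx ⊢
      calc _ ≤ ‖g x‖ * 1 := by gcongr
        _ = _ := mul_one _
    · rw [Set.indicator_of_notMem hxR] at hx ⊢
      rw [le_antisymm hx (norm_nonneg _), mul_zero]
  have hfin := le_of_tendsto' hlim.norm hbound
  have e : (4 * r' * s)⁻¹ • (∫ x in openRect i k c' r' d s, u x) -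
        (4 * r * s)⁻¹ • (∫ x in openRect i k c r d s, u x) =
      (2 * s)⁻¹ • ((2 * r')⁻¹ • (∫ x in openRect i k c' r' d s, u x) -
        (2 * r)⁻¹ • ∫ x in openRect i k c r d s, u x) := by
    rw [smul_sub, smul_smul, smul_smul]
    congr 2
    · field_simp; norm_num
    · field_simp; norm_num
  rw [e, norm_smul, Real.norm_of_nonneg (by positivity)]
  gcongr

/-- The average of `u` over the open cube with centre `c` and side `ℓ`. -/
noncomputable def cubeAverage (c : Plane) (ℓ : ℝ) (u : Plane → ℂ) : ℂ :=
  (ℓ ^ 2)⁻¹ • ∫ x in openCube c ℓ, u x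

lemma openCube_eq_openRect (c : Plane) (ℓ : ℝ) :
    openCube c ℓ = openRect 0 1 (c 0) (ℓ / 2) (c 1) (ℓ / 2) := by
  ext x
  simp [openCube, openRect, Fin.forall_fin_two]

lemma isOpen_openCube (c : Plane) (ℓ : ℝ) : IsOpen (openCube c ℓ) := by
  rw [openCube_eq_openRect]
  exact isOpen_openRect ..

lemma openRect_swap (i k : Fin 2) (c r d s : ℝ) : openRect i k c r d s = openRect k i d s c r := by
  ext x
  exact and_comm

/-- The comparison of two nested cubes, by shrinking one direction after the other. -/
lemma norm_cubeAverage_sub_le {Q : Set Plane} {u : Plane → ℂ}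
    {g : Plane → EuclideanSpace ℂ (Fin 2)} (hu : IntegrableOn u Q) (hg : IntegrableOn g Q)
    (hug : ∀ φ : Plane → ℂ, IsTestFunction Q φ → ∀ i : Fin 2,
      ∫ x in Q, u x * partialDeriv i φ x = -∫ x in Q, g x i * φ x)
    {c c' : Plane} {ℓ ℓ' : ℝ} (hℓ' : 0 < ℓ') (h1 : ∀ i, c i - ℓ / 2 ≤ c' i - ℓ' / 2)
    (h2 : ∀ i, c' i + ℓ' / 2 ≤ c i + ℓ / 2) (hsub : openCube c ℓ ⊆ Q) :
    ‖cubeAverage c' ℓ' u - cubeAverage c ℓ u‖ ≤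
      (ℓ⁻¹ + ℓ'⁻¹) * ∫ x in openCube c ℓ, ‖g x‖ := by
  have hℓ : 0 < ℓ := by linarith [h1 0, h2 0]
  have hmid : openRect 0 1 (c' 0) (ℓ' / 2) (c 1) (ℓ / 2) ⊆ openCube c ℓ := by
    rw [openCube_eq_openRect]
    intro x hx
    have := abs_lt.mp hx.1
    exact ⟨abs_lt.mpr ⟨by linarith [h1 0], by linarith [h2 0]⟩, hx.2⟩
  have s1 := norm_average_sub_average_le hu hg hug (i := 0) (k := 1) (by decide)
    (half_pos hℓ') (half_pos hℓ) (h1 0) (h2 0) (by rwa [← openCube_eq_openRect c ℓ])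
  have s2 := norm_average_sub_average_le hu hg hug (i := 1) (k := 0) (by decide)
    (half_pos hℓ') (half_pos hℓ') (h1 1) (h2 1)
    (by rw [openRect_swap]; exact hmid.trans hsub)
  rw [← openCube_eq_openRect] at s1
  rw [openRect_swap, ← openCube_eq_openRect, openRect_swap 1 0] at s2
  have hmono : ∫ x in openRect 0 1 (c' 0) (ℓ' / 2) (c 1) (ℓ / 2), ‖g x‖ ≤
      ∫ x in openCube c ℓ, ‖g x‖ :=
    setIntegral_mono_set (hg.mono_set hsub).norm
      (Filter.Eventually.of_forall fun x => norm_nonneg _) hmid.eventuallyLE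
  have e1 : 4 * (ℓ' / 2) * (ℓ / 2) = ℓ' * ℓ := by ring
  have e2 : 4 * (ℓ / 2) * (ℓ / 2) = ℓ ^ 2 := by ring
  have e3 : 4 * (ℓ' / 2) * (ℓ' / 2) = ℓ' ^ 2 := by ring
  have e4 : 4 * (ℓ / 2) * (ℓ' / 2) = ℓ' * ℓ := by ring
  rw [e1, e2, mul_div_cancel₀ _ two_ne_zero] at s1
  rw [e3, e4, mul_div_cancel₀ _ two_ne_zero] at s2
  rw [cubeAverage, cubeAverage, add_mul, add_comm]
  refine (norm_sub_le_norm_sub_add_norm_sub _ ((ℓ' * ℓ)⁻¹ •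
    ∫ x in openRect 0 1 (c' 0) (ℓ' / 2) (c 1) (ℓ / 2), u x) _).trans (add_le_add ?_ s1)
  exact s2.trans (by gcongr)

/-! ### Telescoping over cubes contracting to a point -/

/-- The cube obtained from `openCube a L` by the contraction with fixed point `x` and ratio
`2⁻ʲ`. -/
def contractedCube (a : Plane) (L : ℝ) (x : Plane) (j : ℕ) : Set Plane :=
  openCube (x + (1 / 2 : ℝ) ^ j • (a - x)) ((1 / 2) ^ j * L)

lemma mem_contractedCube {a : Plane} {L : ℝ} {x : Plane} (hx : x ∈ openCube a L) (j : ℕ) :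
    x ∈ contractedCube a L x j := by
  intro i
  have h : x i - (x + (1 / 2 : ℝ) ^ j • (a - x)) i = (1 / 2) ^ j * (x i - a i) := by
    simp; ring
  rw [h, abs_mul, abs_of_pos (by positivity), mul_div_assoc]
  have := hx i
  gcongr

lemma contractedCube_bounds {a : Plane} {L : ℝ} {x : Plane} (hx : x ∈ openCube a L) {s t : ℝ}
    (hst : s ≤ t) (i : Fin 2) :
    (x + t • (a - x)) i - t * L / 2 ≤ (x + s • (a - x)) i - s * L / 2 ∧
    (x + s • (a - x)) i + s * L / 2 ≤ (x + t • (a - x)) i + t * L / 2 := by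
  have := abs_lt.mp (hx i)
  simp only [PiLp.add_apply, PiLp.smul_apply, PiLp.sub_apply, smul_eq_mul]
  constructor <;> nlinarith

lemma contractedCube_subset {a : Plane} {L : ℝ} {x : Plane} (hx : x ∈ openCube a L) (j : ℕ) :
    contractedCube a L x j ⊆ openCube a L := by
  intro y hy i
  have h := contractedCube_bounds hx (pow_le_one₀ (n := j) (by norm_num) (by norm_num) :
    (1 / 2 : ℝ) ^ j ≤ 1) i
  have hy' := abs_lt.mp (hy i)
  simp only [one_smul, add_sub_cancel, one_mul] at h
  exact abs_lt.mpr ⟨by linarith, by linarith⟩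

lemma sum_two_pow_le (n : ℕ) {C : ℝ} (hC : 0 ≤ C) :
    ∑ j ∈ Finset.range n, (if (2 : ℝ) ^ j ≤ C then (2 : ℝ) ^ j else 0) ≤ 2 * C := by
  induction n with
  | zero => simpa using hC
  | succ n ih =>
    by_cases h : (2 : ℝ) ^ n ≤ C
    · calc _ ≤ ∑ j ∈ Finset.range (n + 1), (2 : ℝ) ^ j :=
            Finset.sum_le_sum fun j _ => by split_ifs <;> first | exact le_rfl | positivity
        _ ≤ 2 * C := by
            rw [geom_sum_eq (by norm_num), pow_succ]
            linarith
    · rw [Finset.sum_range_succ, if_neg h, add_zero]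
      exact ih

/-- The weights `3 / ℓⱼ` of the cubes containing both `x` and `y` form a geometric series whose
largest term is comparable to `1 / |x - y|`. -/
lemma sum_indicator_contractedCube_le {a : Plane} {L : ℝ} (hL : 0 < L) {x : Plane}
    (hx : x ∈ openCube a L) (n : ℕ) (y : Plane) :
    ∑ j ∈ Finset.range n, (contractedCube a L x j).indicator
      (fun _ => ENNReal.ofReal (3 * 2 ^ j / L)) y ≤ 12 * ‖x - y‖ₑ⁻¹ := by
  rcases eq_or_ne x y with rfl | hxy
  · simp
  have hd : 0 < ‖x - y‖ := norm_pos_iff.mpr (sub_ne_zero.mpr hxy)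
  have hterm : ∀ j, (contractedCube a L x j).indicator
      (fun _ => ENNReal.ofReal (3 * 2 ^ j / L)) y ≤ ENNReal.ofReal
        ((3 / L) * (if (2 : ℝ) ^ j ≤ 2 * L / ‖x - y‖ then (2 : ℝ) ^ j else 0)) := by
    intro j
    by_cases hy : y ∈ contractedCube a L x j
    · rw [Set.indicator_of_mem hy, if_pos]
      · exact ENNReal.ofReal_le_ofReal (le_of_eq (by ring))
      · rw [le_div_iff₀ hd]
        have hn : ‖x - y‖ ≤ 2 * ((1 / 2) ^ j * L) := by
          refine norm_le_of_abs_le fun i => ?_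
          have h1 := abs_lt.mp (mem_contractedCube hx j i)
          have h2 := abs_lt.mp (hy i)
          rw [PiLp.sub_apply]
          exact abs_le.mpr ⟨by linarith, by linarith⟩
        calc (2 : ℝ) ^ j * ‖x - y‖ ≤ 2 ^ j * (2 * ((1 / 2) ^ j * L)) := by gcongr
          _ = (2 * (1 / 2)) ^ j * (2 * L) := by rw [mul_pow]; ring
          _ = 2 * L := by norm_num
    · rw [Set.indicator_of_notMem hy]; exact zero_le
  refine (Finset.sum_le_sum fun j _ => hterm j).trans ?_
  rw [← ENNReal.ofReal_sum_of_nonneg fun j _ => by positivity, ← Finset.mul_sum]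
  have h := sum_two_pow_le n (C := 2 * L / ‖x - y‖) (by positivity)
  have h12 : 12 * ‖x - y‖ₑ⁻¹ = ENNReal.ofReal (3 / L * (2 * (2 * L / ‖x - y‖))) := by
    rw [show 3 / L * (2 * (2 * L / ‖x - y‖)) = 12 * ‖x - y‖⁻¹ by field_simp; norm_num,
      ENNReal.ofReal_mul (by norm_num), ENNReal.ofReal_inv_of_pos hd, ofReal_norm,
      ENNReal.ofReal_ofNat]
  rw [h12]
  exact ENNReal.ofReal_le_ofReal (by gcongr)

/-- Telescoping along the contracted cubes. -/
lemma enorm_cubeAverage_contracted_sub_le {a : Plane} {L : ℝ} (hL : 0 < L) {u : Plane → ℂ}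
    {g : Plane → EuclideanSpace ℂ (Fin 2)} (hu : IntegrableOn u (openCube a L))
    (hg : IntegrableOn g (openCube a L))
    (hug : ∀ φ : Plane → ℂ, IsTestFunction (openCube a L) φ → ∀ i : Fin 2,
      ∫ x in openCube a L, u x * partialDeriv i φ x = -∫ x in openCube a L, g x i * φ x)
    {x : Plane} (hx : x ∈ openCube a L) (n : ℕ) :
    ‖cubeAverage (x + (1 / 2 : ℝ) ^ n • (a - x)) ((1 / 2) ^ n * L) u - cubeAverage a L u‖ₑ ≤
      12 * rieszPotential (openCube a L) (fun y => ‖g y‖ₑ) x := by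
  set A : ℕ → ℂ := fun j => cubeAverage (x + (1 / 2 : ℝ) ^ j • (a - x)) ((1 / 2) ^ j * L) u with hA
  have hA0 : cubeAverage a L u = A 0 := by simp [hA]
  have hstep : ∀ j, ‖A (j + 1) - A j‖ₑ ≤ ∫⁻ y in openCube a L,
      (contractedCube a L x j).indicator (fun _ => ENNReal.ofReal (3 * 2 ^ j / L)) y * ‖g y‖ₑ := by
    intro j
    have hle : (1 / 2 : ℝ) ^ (j + 1) ≤ (1 / 2) ^ j :=
      pow_le_pow_of_le_one (by norm_num) (by norm_num) (by omega)
    have h := norm_cubeAverage_sub_le hu hg hug (by positivity)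
      (fun i => (contractedCube_bounds hx hle i).1) (fun i => (contractedCube_bounds hx hle i).2)
      (contractedCube_subset hx j)
    have hgi : Integrable g (volume.restrict (contractedCube a L x j)) :=
      hg.mono_set (contractedCube_subset hx j)
    have hc : ((1 / 2 : ℝ) ^ j * L)⁻¹ + ((1 / 2 : ℝ) ^ (j + 1) * L)⁻¹ = 3 * 2 ^ j / L := by
      simp only [one_div, inv_pow, pow_succ]
      field_simp
      norm_num
    rw [hc] at h
    have h' : ‖A (j + 1) - A j‖ ≤ 3 * 2 ^ j / L * ∫ y in contractedCube a L x j, ‖g y‖ := h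
    rw [← ofReal_norm]
    refine (ENNReal.ofReal_le_ofReal h').trans ?_
    rw [ENNReal.ofReal_mul (by positivity), ofReal_integral_norm_eq_lintegral_enorm hgi]
    have hm : MeasurableSet (contractedCube a L x j) := (isOpen_openCube _ _).measurableSet
    rw [← lintegral_const_mul'' _ hgi.aestronglyMeasurable.enorm]
    refine le_of_eq ?_
    have e : ∀ y, (contractedCube a L x j).indicator
        (fun _ => ENNReal.ofReal (3 * 2 ^ j / L)) y * ‖g y‖ₑ = (contractedCube a L x j).indicator
        (fun y => ENNReal.ofReal (3 * 2 ^ j / L) * ‖g y‖ₑ) y := fun y => by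
      by_cases hy : y ∈ contractedCube a L x j <;> simp [hy]
    simp_rw [e]
    rw [setLIntegral_indicator hm, Set.inter_eq_left.mpr (contractedCube_subset hx j)]
  have hm : ∀ j, Measurable ((contractedCube a L x j).indicator
      (fun _ => ENNReal.ofReal (3 * 2 ^ j / L))) := fun j =>
    measurable_const.indicator (isOpen_openCube _ _).measurableSet
  have hgm : AEMeasurable (fun y => ‖g y‖ₑ) (volume.restrict (openCube a L)) :=
    hg.aestronglyMeasurable.enorm
  calc ‖A n - cubeAverage a L u‖ₑ = ‖∑ j ∈ Finset.range n, (A (j + 1) - A j)‖ₑ := by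
        rw [Finset.sum_range_sub, hA0]
    _ ≤ ∑ j ∈ Finset.range n, ‖A (j + 1) - A j‖ₑ := enorm_sum_le _ _
    _ ≤ ∑ j ∈ Finset.range n, ∫⁻ y in openCube a L,
          (contractedCube a L x j).indicator (fun _ => ENNReal.ofReal (3 * 2 ^ j / L)) y * ‖g y‖ₑ :=
        Finset.sum_le_sum fun j _ => hstep j
    _ = ∫⁻ y in openCube a L, (∑ j ∈ Finset.range n, (contractedCube a L x j).indicator
          (fun _ => ENNReal.ofReal (3 * 2 ^ j / L)) y) * ‖g y‖ₑ := by
        simp_rw [Finset.sum_mul]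
        exact (lintegral_finsetSum' _ fun j _ => (hm j).aemeasurable.mul hgm).symm
    _ ≤ ∫⁻ y in openCube a L, 12 * (‖g y‖ₑ * ‖x - y‖ₑ⁻¹) := by
        refine lintegral_mono fun y => ?_
        rw [mul_left_comm, mul_comm]
        gcongr
        exact sum_indicator_contractedCube_le hL hx n y
    _ = _ := by
        rw [rieszPotential, lintegral_const_mul' _ _ (by norm_num)]

/-! ### Lebesgue points and the potential estimate -/

/-- In coordinates, cubes are balls of the supremum norm. -/
lemma cubeAverage_eq_setAverage (c : Plane) {ℓ : ℝ} (hℓ : 0 < ℓ) (v : Plane → ℂ) :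
    cubeAverage c ℓ v = ⨍ y in Metric.closedBall (WithLp.ofLp c) (ℓ / 2), v (WithLp.toLp 2 y) := by
  have hpre : (WithLp.toLp 2 : (Fin 2 → ℝ) → Plane) ⁻¹' openCube c ℓ =
      Metric.ball (WithLp.ofLp c) (ℓ / 2) := by
    ext y
    rw [Metric.mem_ball, dist_pi_lt_iff (half_pos hℓ)]
    simp [openCube, Real.dist_eq]
  have hint : ∫ x in openCube c ℓ, v x =
      ∫ y in Metric.closedBall (WithLp.ofLp c) (ℓ / 2), v (WithLp.toLp 2 y) := by
    rw [← (PiLp.volume_preserving_toLp (Fin 2)).setIntegral_preimage_emb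
      (MeasurableEquiv.toLp 2 (Fin 2 → ℝ)).measurableEmbedding, hpre]
    refine setIntegral_congr_set ?_
    exact (Metric.ball_subset_closedBall.eventuallyLE).antisymm (by
      rw [ae_le_set, Metric.closedBall_sdiff_ball]
      exact Measure.addHaar_sphere _ _ _)
  rw [cubeAverage, setAverage_eq, hint, Measure.real, Real.volume_pi_closedBall _ (by positivity),
    ENNReal.toReal_ofReal (by positivity), mul_div_cancel₀ _ two_ne_zero, Fintype.card_fin]

lemma ae_tendsto_cubeAverage_contracted {v : Plane → ℂ} (hv : LocallyIntegrable v) {a : Plane}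
    {L : ℝ} (hL : 0 < L) :
    ∀ᵐ x : Plane, x ∈ openCube a L → Filter.Tendsto
      (fun n : ℕ => cubeAverage (x + (1 / 2 : ℝ) ^ n • (a - x)) ((1 / 2) ^ n * L) v) Filter.atTop
        (nhds (v x)) := by
  have hmp := PiLp.volume_preserving_toLp (Fin 2)
  have hv' : LocallyIntegrable (fun y : Fin 2 → ℝ => v (WithLp.toLp 2 y)) := by
    rw [locallyIntegrable_iff] at hv ⊢
    intro K hK
    have hK' := hv _ (hK.image (f := (WithLp.toLp 2 : (Fin 2 → ℝ) → Plane))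
      (PiLp.continuous_toLp 2 _))
    rw [← hmp.integrableOn_comp_preimage
      (MeasurableEquiv.toLp 2 (Fin 2 → ℝ)).measurableEmbedding] at hK'
    exact hK'.mono_set (Set.subset_preimage_image _ _)
  have h := IsUnifLocDoublingMeasure.ae_tendsto_average (μ := volume) hv' 1
  have h2 := (PiLp.volume_preserving_ofLp (Fin 2)).quasiMeasurePreserving.ae h
  filter_upwards [h2] with x hx hxQ
  have h3 := hx (ι := ℕ) (l := Filter.atTop)
    (fun n => WithLp.ofLp (x + (1 / 2 : ℝ) ^ n • (a - x))) (fun n => (1 / 2) ^ n * L / 2) ?_ ?_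
  · refine h3.congr fun n => ?_
    exact (cubeAverage_eq_setAverage _ (by positivity) v).symm
  · refine tendsto_nhdsWithin_iff.mpr ⟨?_, Filter.Eventually.of_forall fun n => ?_⟩
    · have := (tendsto_pow_atTop_nhds_zero_of_lt_one (r := (1 / 2 : ℝ)) (by norm_num)
        (by norm_num)).mul_const (L / 2)
      rw [zero_mul] at this
      refine this.congr fun n => by ring
    · rw [Set.mem_Ioi]; positivity
  · refine Filter.Eventually.of_forall fun n => ?_
    rw [one_mul, Metric.mem_closedBall, dist_pi_le_iff (by positivity)]
    intro i
    rw [Real.dist_eq]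
    exact (mem_contractedCube hxQ n i).le

/-- **Potential estimate.** On a cube, a function with integrable weak gradient differs from its
average by at most a multiple of the Riesz potential of its gradient. -/
theorem ae_enorm_sub_cubeAverage_le {a : Plane} {L : ℝ} (hL : 0 < L) {u : Plane → ℂ}
    {g : Plane → EuclideanSpace ℂ (Fin 2)} (hu : IntegrableOn u (openCube a L))
    (hg : IntegrableOn g (openCube a L))
    (hug : ∀ φ : Plane → ℂ, IsTestFunction (openCube a L) φ → ∀ i : Fin 2,
      ∫ x in openCube a L, u x * partialDeriv i φ x = -∫ x in openCube a L, g x i * φ x) :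
    ∀ᵐ x ∂volume.restrict (openCube a L), ‖u x - cubeAverage a L u‖ₑ ≤
      12 * rieszPotential (openCube a L) (fun y => ‖g y‖ₑ) x := by
  have hm : MeasurableSet (openCube a L) := (isOpen_openCube a L).measurableSet
  have hv : LocallyIntegrable ((openCube a L).indicator u) :=
    (hu.integrable_indicator hm).locallyIntegrable
  rw [ae_restrict_iff' hm]
  filter_upwards [ae_tendsto_cubeAverage_contracted hv (a := a) hL] with x hx hxQ
  have h := hx hxQ
  rw [Set.indicator_of_mem hxQ] at h
  refine le_of_tendsto' (h.sub_const (cubeAverage a L u)).enorm fun n => ?_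
  have e : cubeAverage (x + (1 / 2 : ℝ) ^ n • (a - x)) ((1 / 2) ^ n * L)
      ((openCube a L).indicator u) =
      cubeAverage (x + (1 / 2 : ℝ) ^ n • (a - x)) ((1 / 2) ^ n * L) u := by
    rw [cubeAverage, cubeAverage, setIntegral_indicator hm]
    congr 3
    exact Set.inter_eq_left.mpr (contractedCube_subset hxQ n)
  rw [e]
  exact enorm_cubeAverage_contracted_sub_le hL hu hg hug hxQ n

/-! ### The exponential estimate for extensions by zero -/

lemma volume_openCube_lt_top (a : Plane) (L : ℝ) : volume (openCube a L) < ⊤ := by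
  have h : openCube a L ⊆ Metric.closedBall a (2 * (L / 2)) := fun x hx => by
    rw [Metric.mem_closedBall, dist_eq_norm]
    exact norm_le_of_abs_le fun i => by rw [PiLp.sub_apply]; exact (hx i).le
  exact (measure_mono h).trans_lt measure_closedBall_lt_top

lemma partialDeriv_eq_zero_of_notMem {φ : Plane → ℂ} {x : Plane} (hx : x ∉ tsupport φ)
    (i : Fin 2) : partialDeriv i φ x = 0 := by
  rw [partialDeriv, fderiv_of_notMem_tsupport ℝ hx]
  rfl

lemma IsTestFunction.continuous_partialDeriv {Ω : Set Plane} {φ : Plane → ℂ}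
    (hφ : IsTestFunction Ω φ) (i : Fin 2) : Continuous (partialDeriv i φ) :=
  (hφ.contDiff.continuous_fderiv (by simp)).clm_apply continuous_const

lemma IsTestFunction.hasCompactSupport_partialDeriv {Ω : Set Plane} {φ : Plane → ℂ}
    (hφ : IsTestFunction Ω φ) (i : Fin 2) : HasCompactSupport (partialDeriv i φ) :=
  hφ.hasCompactSupport.of_isClosed_subset (isClosed_tsupport _) <|
    closure_minimal (fun x hx => by
      by_contra h
      exact hx (partialDeriv_eq_zero_of_notMem h i)) (isClosed_tsupport _)

lemma ofReal_l2NormSq {Ω : Set Plane} {g : Plane → EuclideanSpace ℂ (Fin 2)}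
    (hg : MemLp g 2 (volume.restrict Ω)) :
    ENNReal.ofReal (l2NormSq Ω g) = ∫⁻ x in Ω, ‖g x‖ₑ ^ 2 := by
  rw [l2NormSq, ofReal_integral_eq_lintegral_ofReal (hg.integrable_norm_pow two_ne_zero)
    (Filter.Eventually.of_forall fun x => by positivity)]
  simp_rw [ENNReal.ofReal_pow (norm_nonneg _), ofReal_norm]

lemma l2NormSq_nonneg (Ω : Set Plane) (g : Plane → EuclideanSpace ℂ (Fin 2)) :
    0 ≤ l2NormSq Ω g := integral_nonneg fun x => by positivity

/-- The common core of both parts. The hypothesis on test functions says that the extension of `u`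
by zero belongs to `H¹` of the cube, with gradient the extension of `g` by zero. Since this gradient
lives on `Ω`, only the measure of `Ω ∩ openCube a L` enters, not the one of the cube. -/
theorem lintegral_youngA_sub_le_of_extension {Ω : Set Plane} (hΩ : MeasurableSet Ω)
    {u : Plane → ℂ} {g : Plane → EuclideanSpace ℂ (Fin 2)}
    (hu : MemLp u 2 (volume.restrict Ω)) (hg : MemLp g 2 (volume.restrict Ω))
    {a : Plane} {L : ℝ} (hL : 0 < L)
    (hug : ∀ φ : Plane → ℂ, IsTestFunction (openCube a L) φ → ∀ i : Fin 2,
      ∫ x in Ω, u x * partialDeriv i φ x = -∫ x in Ω, g x i * φ x) :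
    (l2NormSq Ω g = 0 → ∀ᵐ x ∂volume.restrict (Ω ∩ openCube a L),
      u x = (L ^ 2)⁻¹ • ∫ x in Ω ∩ openCube a L, u x) ∧
    ∫⁻ x in Ω ∩ openCube a L, ENNReal.ofReal (youngA (1 / 13824 *
      ‖u x - (L ^ 2)⁻¹ • ∫ x in Ω ∩ openCube a L, u x‖ ^ 2 / l2NormSq Ω g)) ≤
        volume (Ω ∩ openCube a L) := by
  have hQ : MeasurableSet (openCube a L) := (isOpen_openCube a L).measurableSet
  have hE : MeasurableSet (Ω ∩ openCube a L) := hΩ.inter hQ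
  have hEfin : volume (Ω ∩ openCube a L) ≠ ⊤ :=
    ((measure_mono Set.inter_subset_right).trans_lt (volume_openCube_lt_top a L)).ne
  have : IsFiniteMeasure (volume.restrict (Ω ∩ openCube a L)) :=
    ⟨by rw [Measure.restrict_apply_univ]; exact hEfin.lt_top⟩
  have hu1 : IntegrableOn u (Ω ∩ openCube a L) :=
    (hu.mono_measure (Measure.restrict_mono_set _ Set.inter_subset_left)).integrable
      (by norm_num)
  have hg1 : IntegrableOn g (Ω ∩ openCube a L) :=
    (hg.mono_measure (Measure.restrict_mono_set _ Set.inter_subset_left)).integrable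
      (by norm_num)
  have huQ : IntegrableOn (Ω.indicator u) (openCube a L) := by
    rw [IntegrableOn, integrable_indicator_iff hΩ, IntegrableOn, Measure.restrict_restrict hΩ]
    exact hu1
  have hgQ : IntegrableOn (Ω.indicator g) (openCube a L) := by
    rw [IntegrableOn, integrable_indicator_iff hΩ, IntegrableOn, Measure.restrict_restrict hΩ]
    exact hg1
  -- a function supported in the cube may be integrated over `Ω` or over the cube
  have hswap : ∀ w : Plane → ℂ, (∀ x ∉ openCube a L, w x = 0) →
      ∫ x in openCube a L, Ω.indicator w x = ∫ x in Ω, w x := by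
    intro w hw
    rw [setIntegral_indicator hΩ, Set.inter_comm, ← setIntegral_indicator hQ]
    congr 1 with x
    by_cases hx : x ∈ openCube a L <;> simp [hx, hw]
  have hweak : ∀ φ : Plane → ℂ, IsTestFunction (openCube a L) φ → ∀ i : Fin 2,
      ∫ x in openCube a L, Ω.indicator u x * partialDeriv i φ x =
        -∫ x in openCube a L, Ω.indicator g x i * φ x := by
    intro φ hφ i
    have h1 := hswap (fun x => u x * partialDeriv i φ x) fun x hx => by
      rw [partialDeriv_eq_zero_of_notMem (fun h => hx (hφ.tsupport_subset h)), mul_zero]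
    have h2 := hswap (fun x => g x i * φ x) fun x hx => by
      rw [image_eq_zero_of_notMem_tsupport (fun h => hx (hφ.tsupport_subset h)), mul_zero]
    have := hug φ hφ i
    rw [← h1, ← h2] at this
    have e1 : ∀ x, Ω.indicator u x * partialDeriv i φ x =
        Ω.indicator (fun x => u x * partialDeriv i φ x) x := fun x => by
      by_cases hx : x ∈ Ω <;> simp [hx]
    have e2 : ∀ x, Ω.indicator g x i * φ x = Ω.indicator (fun x => g x i * φ x) x := fun x => by
      by_cases hx : x ∈ Ω <;> simp [hx]
    simpa only [e1, e2] using this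
  have hpot := ae_enorm_sub_cubeAverage_le hL huQ hgQ hweak
  have havg : cubeAverage a L (Ω.indicator u) = (L ^ 2)⁻¹ • ∫ x in Ω ∩ openCube a L, u x := by
    rw [cubeAverage, setIntegral_indicator hΩ, Set.inter_comm]
  set c := (L ^ 2)⁻¹ • ∫ x in Ω ∩ openCube a L, u x with hc
  set f : Plane → ℝ≥0∞ := fun y => ‖hg1.aestronglyMeasurable.mk g y‖ₑ with hf
  have hfm : Measurable f := hg1.aestronglyMeasurable.stronglyMeasurable_mk.enorm
  have hfg : ∀ᵐ y ∂volume.restrict (Ω ∩ openCube a L), ‖g y‖ₑ = f y := by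
    filter_upwards [hg1.aestronglyMeasurable.ae_eq_mk] with y hy
    rw [hf, hy]
  have hV : ∀ x, rieszPotential (openCube a L) (fun y => ‖Ω.indicator g y‖ₑ) x =
      rieszPotential (Ω ∩ openCube a L) f x := by
    intro x
    have e : (fun y => ‖Ω.indicator g y‖ₑ * ‖x - y‖ₑ⁻¹) =
        Ω.indicator fun y => ‖g y‖ₑ * ‖x - y‖ₑ⁻¹ := by
      funext y
      by_cases hy : y ∈ Ω <;> simp [hy]
    rw [rieszPotential, e, setLIntegral_indicator hΩ, rieszPotential]
    refine lintegral_congr_ae ?_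
    filter_upwards [hfg] with y hy
    rw [hy]
  have hpot' : ∀ᵐ x ∂volume.restrict (Ω ∩ openCube a L), ‖u x - c‖ₑ ≤
      12 * rieszPotential (Ω ∩ openCube a L) f x := by
    have h1 := ae_restrict_of_ae_restrict_of_subset
      (Set.inter_subset_right : Ω ∩ openCube a L ⊆ openCube a L) hpot
    filter_upwards [h1, ae_restrict_mem hE] with x hx hxE
    rwa [havg, hV, Set.indicator_of_mem hxE.1] at hx
  have hfD : ∫⁻ y in Ω ∩ openCube a L, f y ^ 2 ≤ ENNReal.ofReal (l2NormSq Ω g) := by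
    rw [ofReal_l2NormSq hg]
    refine le_trans (le_of_eq (lintegral_congr_ae ?_)) (lintegral_mono_set Set.inter_subset_left)
    filter_upwards [hfg] with y hy
    rw [hy]
  refine ⟨fun hD => ?_, lintegral_youngA_le hE hEfin hfm hpot' (l2NormSq_nonneg Ω g) hfD⟩
  -- if the gradient vanishes, so does its potential
  have h0 : ∀ᵐ y ∂volume.restrict (Ω ∩ openCube a L), f y = 0 := by
    rw [hD, ENNReal.ofReal_zero, nonpos_iff_eq_zero, lintegral_eq_zero_iff (by fun_prop)] at hfD
    filter_upwards [hfD] with y hy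
    simpa using hy
  filter_upwards [hpot'] with x hx
  have hV0 : rieszPotential (Ω ∩ openCube a L) f x = 0 := by
    rw [rieszPotential, ← lintegral_zero (μ := volume.restrict (Ω ∩ openCube a L))]
    refine lintegral_congr_ae ?_
    filter_upwards [h0] with y hy
    rw [hy, zero_mul]
  rw [hV0, mul_zero, nonpos_iff_eq_zero, enorm_eq_zero, sub_eq_zero] at hx
  exact hx

/-! ### Weak gradients of extensions by zero -/

/-- The weak gradient of an `H¹₀` function may be tested against functions which do not vanish
outside `Ω`: this holds for test functions and passes to the limit. -/
lemma HasH10Grad.integral_mul_partialDeriv {Ω : Set Plane} {u : Plane → ℂ}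
    {g : Plane → EuclideanSpace ℂ (Fin 2)} (h : HasH10Grad Ω u g) {W : Set Plane} {φ : Plane → ℂ}
    (hφ : IsTestFunction W φ) (i : Fin 2) :
    ∫ x in Ω, u x * partialDeriv i φ x = -∫ x in Ω, g x i * φ x := by
  have hdc := hφ.continuous_partialDeriv i
  have hφc := hφ.contDiff.continuous
  have hd2 : MemLp (partialDeriv i φ) 2 (volume.restrict Ω) :=
    (hdc.memLp_of_hasCompactSupport (hφ.hasCompactSupport_partialDeriv i)).restrict Ω
  have hφ2 : MemLp φ 2 (volume.restrict Ω) :=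
    (hφc.memLp_of_hasCompactSupport hφ.hasCompactSupport).restrict Ω
  have hgi : MemLp (fun x => g x i) 2 (volume.restrict Ω) :=
    h.memLp_grad.mono (by
      have := h.memLp_grad.aestronglyMeasurable
      exact (PiLp.continuous_apply 2 _ i).comp_aestronglyMeasurable this)
      (Filter.Eventually.of_forall fun x => PiLp.norm_apply_le (g x) i)
  set M := eLpNorm (partialDeriv i φ) 2 (volume.restrict Ω) + eLpNorm φ 2 (volume.restrict Ω)
  have hM : M ≠ ⊤ := ENNReal.add_ne_top.mpr ⟨hd2.eLpNorm_ne_top, hφ2.eLpNorm_ne_top⟩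
  set X := ∫ x in Ω, u x * partialDeriv i φ x + g x i * φ x with hX
  have hI1 : IntegrableOn (fun x => u x * partialDeriv i φ x) Ω := h.memLp.integrable_mul hd2
  have hI2 : IntegrableOn (fun x => g x i * φ x) Ω := hgi.integrable_mul hφ2
  have hbound : ∀ ε : ℝ≥0∞, 0 < ε → ‖X‖ₑ ≤ ε * M := by
    intro ε hε
    obtain ⟨ψ, hψ, hψu, hψg⟩ := h.exists_approx ε hε
    have hψc := hψ.contDiff.continuous
    have hψd := hψ.continuous_partialDeriv i
    have hψ2 : MemLp ψ 2 (volume.restrict Ω) :=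
      (hψc.memLp_of_hasCompactSupport hψ.hasCompactSupport).restrict Ω
    have hψd2 : MemLp (partialDeriv i ψ) 2 (volume.restrict Ω) :=
      (hψd.memLp_of_hasCompactSupport (hψ.hasCompactSupport_partialDeriv i)).restrict Ω
    have hJ1 : IntegrableOn (fun x => ψ x * partialDeriv i φ x) Ω := hψ2.integrable_mul hd2
    have hJ2 : IntegrableOn (fun x => partialDeriv i ψ x * φ x) Ω := hψd2.integrable_mul hφ2
    have hk1 : Integrable (fun x => ψ x * partialDeriv i φ x) :=
      (hψc.mul hdc).integrable_of_hasCompactSupport hψ.hasCompactSupport.mul_right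
    have hk2 : Integrable (fun x => partialDeriv i ψ x * φ x) :=
      (hψd.mul hφc).integrable_of_hasCompactSupport hφ.hasCompactSupport.mul_left
    -- the classical integration by parts
    have hparts : ∫ x in Ω, (ψ x * partialDeriv i φ x + partialDeriv i ψ x * φ x) = 0 := by
      rw [setIntegral_eq_integral_of_forall_compl_eq_zero]
      · have e := integral_mul_fderiv_eq_neg_fderiv_mul_of_integrable (μ := (volume : Measure Plane))
          (f := ψ) (g := φ) (v := EuclideanSpace.single i 1)
          hk2 hk1
          ((hψc.mul hφc).integrable_of_hasCompactSupport hφ.hasCompactSupport.mul_left)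
          (fun x _ => hψ.contDiff.differentiable (by simp) x)
          (fun x _ => hφ.contDiff.differentiable (by simp) x)
        rw [integral_add hk1 hk2]
        exact eq_neg_iff_add_eq_zero.mp e
      · intro x hx
        have hx' : x ∉ tsupport ψ := fun h => hx (hψ.tsupport_subset h)
        rw [image_eq_zero_of_notMem_tsupport hx', partialDeriv_eq_zero_of_notMem hx']
        simp
    have hXe : X = ∫ x in Ω, ((u x - ψ x) * partialDeriv i φ x +
        (g x - classicalGrad ψ x) i * φ x) := by
      have hI : IntegrableOn (fun x => u x * partialDeriv i φ x + g x i * φ x) Ω := hI1.add hI2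
      have hJ : IntegrableOn (fun x => ψ x * partialDeriv i φ x + partialDeriv i ψ x * φ x) Ω :=
        hJ1.add hJ2
      rw [hX, ← sub_zero (∫ x in Ω, _), ← hparts, ← integral_sub hI hJ]
      refine integral_congr_ae (Filter.Eventually.of_forall fun x => ?_)
      simp only [PiLp.sub_apply, classicalGrad]
      ring
    have hsub1 : AEStronglyMeasurable (fun x => u x - ψ x) (volume.restrict Ω) :=
      (h.memLp.sub hψ2).aestronglyMeasurable
    have hsub2 : AEStronglyMeasurable (fun x => (g x - classicalGrad ψ x) i)
        (volume.restrict Ω) := (hgi.sub hψd2).aestronglyMeasurable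
    have hold : ∀ p q : Plane → ℂ, AEStronglyMeasurable p (volume.restrict Ω) →
        AEStronglyMeasurable q (volume.restrict Ω) → eLpNorm p 2 (volume.restrict Ω) ≤ ε →
        ∫⁻ x in Ω, ‖p x * q x‖ₑ ≤ ε * eLpNorm q 2 (volume.restrict Ω) := by
      intro p q hp hq hpε
      have := eLpNorm_smul_le_mul_eLpNorm (p := 2) (q := 2) (r := 1) hq hp
      rw [eLpNorm_one_eq_lintegral_enorm] at this
      exact this.trans (by gcongr)
    rw [hXe, mul_add]
    refine (enorm_integral_le_lintegral_enorm _).trans ?_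
    refine (lintegral_mono fun x => enorm_add_le _ _).trans ?_
    have hm : AEMeasurable (fun x => ‖(u x - ψ x) * partialDeriv i φ x‖ₑ) (volume.restrict Ω) :=
      (hsub1.mul hd2.aestronglyMeasurable).enorm
    rw [lintegral_add_left' hm]
    refine add_le_add (hold _ _ hsub1 hd2.aestronglyMeasurable hψu.le)
      (hold _ _ hsub2 hφ2.aestronglyMeasurable (le_trans ?_ hψg.le))
    exact eLpNorm_mono fun x => PiLp.norm_apply_le (g x - classicalGrad ψ x) i
  have hX0 : ‖X‖ₑ ≤ 0 := by
    have ht : Filter.Tendsto (fun n : ℕ => ((n : ℝ≥0∞) + 1)⁻¹ * M) Filter.atTop (nhds (0 * M)) := by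
      refine ENNReal.Tendsto.mul_const ?_ (Or.inr hM)
      have := (Filter.tendsto_add_atTop_iff_nat 1).mpr ENNReal.tendsto_inv_nat_nhds_zero
      simpa using this
    rw [zero_mul] at ht
    exact ge_of_tendsto' ht fun n => hbound _ (ENNReal.inv_pos.mpr (by simp))
  rw [nonpos_iff_eq_zero, enorm_eq_zero, hX, integral_add hI1 hI2] at hX0
  exact eq_neg_iff_add_eq_zero.mpr hX0

/-- A weak gradient vanishes wherever the function does. -/
lemma HasH1Grad.grad_eq_zero {Ω : Set Plane} (hΩ : IsOpen Ω) {u : Plane → ℂ}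
    {g : Plane → EuclideanSpace ℂ (Fin 2)} (h : HasH1Grad Ω u g) {U : Set Plane} (hU : IsOpen U)
    (hu : ∀ᵐ x ∂(volume.restrict (U ∩ Ω)), u x = 0) (i : Fin 2) :
    ∀ᵐ x ∂(volume.restrict (U ∩ Ω)), g x i = 0 := by
  have hO : IsOpen (U ∩ Ω) := hU.inter hΩ
  have hu' := (ae_restrict_iff' hO.measurableSet).mp hu
  have hgi : MemLp (fun x => g x i) 2 (volume.restrict Ω) :=
    h.memLp_grad.mono (by
      have := h.memLp_grad.aestronglyMeasurable
      exact (PiLp.continuous_apply 2 _ i).comp_aestronglyMeasurable this)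
      (Filter.Eventually.of_forall fun x => PiLp.norm_apply_le (g x) i)
  have hloc : LocallyIntegrableOn (fun x => g x i) (U ∩ Ω) := by
    refine LocallyIntegrableOn.mono_set ?_ (Set.inter_subset_right : U ∩ Ω ⊆ Ω)
    exact locallyIntegrableOn_of_locallyIntegrable_restrict
      (hgi.locallyIntegrable (by norm_num))
  rw [ae_restrict_iff' hO.measurableSet]
  refine hO.ae_eq_zero_of_integral_contDiff_smul_eq_zero hloc fun η hη hηc hηs => ?_
  have hsupp : tsupport (fun x => (η x : ℂ)) ⊆ tsupport η :=
    closure_mono fun x hx h0 => hx (by simp [h0])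
  have hφ : IsTestFunction Ω fun x => (η x : ℂ) :=
    ⟨Complex.ofRealCLM.contDiff.comp hη, hηc.of_isClosed_subset (isClosed_tsupport _) hsupp,
      (hsupp.trans hηs).trans Set.inter_subset_right⟩
  have e := h.integral_eq _ hφ i
  have e0 : ∫ x in Ω, u x * partialDeriv i (fun x => (η x : ℂ)) x = 0 := by
    refine integral_eq_zero_of_ae ?_
    filter_upwards [ae_restrict_of_ae hu'] with x hx
    by_cases hxs : x ∈ tsupport η
    · simp [hx (hηs hxs)]
    · rw [partialDeriv_eq_zero_of_notMem fun hh => hxs (hsupp hh), mul_zero]; rfl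
  rw [e0, zero_eq_neg] at e
  rw [← e, setIntegral_eq_integral_of_forall_compl_eq_zero]
  · refine integral_congr_ae (Filter.Eventually.of_forall fun x => ?_)
    simp [mul_comm]
  · intro x hx
    have : η x = 0 := image_eq_zero_of_notMem_tsupport fun hh => hx (hηs hh).2
    simp [this]

/-- If `u ∈ H¹(Ω)` vanishes near `Q ∩ ∂Ω`, its weak gradient may be tested against every test
function of `Q`: a cutoff which equals `1` near the compact part of `Ω` that matters turns it into a
test function of `Ω`. -/
lemma HasH1Grad.integral_mul_partialDeriv_of_vanishesNear {Ω : Set Plane} (hΩ : IsOpen Ω)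
    {u : Plane → ℂ} {g : Plane → EuclideanSpace ℂ (Fin 2)} (h : HasH1Grad Ω u g) {Q : Set Plane}
    (hv : VanishesNear Ω (Q ∩ frontier Ω) u) {φ : Plane → ℂ} (hφ : IsTestFunction Q φ)
    (i : Fin 2) : ∫ x in Ω, u x * partialDeriv i φ x = -∫ x in Ω, g x i * φ x := by
  obtain ⟨U, hU, hKU, hu0⟩ := hv
  have hg0 := h.grad_eq_zero hΩ hU hu0 i
  rw [ae_restrict_iff' (hU.inter hΩ).measurableSet] at hu0 hg0
  set K := (tsupport φ ∩ closure Ω) \ U with hK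
  have hKc : IsCompact K :=
    (hφ.hasCompactSupport.isCompact.inter_right isClosed_closure).diff hU
  have hKΩ : K ⊆ Ω := fun x hx => by
    by_contra hxΩ
    refine hx.2 (hKU ⟨hφ.tsupport_subset hx.1.1, hx.1.2, ?_⟩)
    rwa [hΩ.interior_eq]
  obtain ⟨K', hK'c, hKK', hK'Ω⟩ := exists_compact_between hKc hΩ hKΩ
  obtain ⟨χ, hχ1, hχ0, -⟩ := exists_contMDiffMap_one_nhds_of_subset_interior (n := ⊤)
    (modelWithCornersSelf ℝ Plane) hKc.isClosed hKK'
  have hχsm : ContDiff ℝ ∞ χ := χ.contMDiff.contDiff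
  set ψ : Plane → ℂ := fun x => (χ x : ℂ) * φ x with hψ
  have hψK' : tsupport ψ ⊆ K' := closure_minimal (fun x hx => by
    by_contra hxK
    exact hx (by simp [hψ, hχ0 x hxK])) hK'c.isClosed
  have hψt : IsTestFunction Ω ψ :=
    ⟨(Complex.ofRealCLM.contDiff.comp hχsm).mul hφ.contDiff,
      hK'c.of_isClosed_subset (isClosed_tsupport _) hψK', hψK'.trans hK'Ω⟩
  -- off `U`, the function and its cut-off version agree near every point of `Ω`
  have hloc : ∀ x ∈ Ω, x ∉ U → ψ =ᶠ[nhds x] φ := by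
    intro x hxΩ hxU
    by_cases hxφ : x ∈ tsupport φ
    · have hxK : x ∈ K := ⟨⟨hxφ, subset_closure hxΩ⟩, hxU⟩
      filter_upwards [Filter.eventually_iff_exists_mem.mp hχ1 |>.elim fun s hs =>
        Filter.mem_of_superset (mem_nhdsSet_iff_forall.mp hs.1 x hxK) hs.2] with y hy
      have hy' : χ y = 1 := hy
      simp [hψ, hy']
    · filter_upwards [(isClosed_tsupport φ).isOpen_compl.mem_nhds hxφ] with y hy
      simp [hψ, image_eq_zero_of_notMem_tsupport hy]
  have e := h.integral_eq ψ hψt i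
  have e1 : ∫ x in Ω, u x * partialDeriv i ψ x = ∫ x in Ω, u x * partialDeriv i φ x := by
    refine integral_congr_ae ?_
    filter_upwards [ae_restrict_of_ae hu0, ae_restrict_mem hΩ.measurableSet] with x hx hxΩ
    by_cases hxU : x ∈ U
    · simp [hx ⟨hxU, hxΩ⟩]
    · rw [partialDeriv, partialDeriv, (hloc x hxΩ hxU).fderiv_eq]
  have e2 : ∫ x in Ω, g x i * ψ x = ∫ x in Ω, g x i * φ x := by
    refine integral_congr_ae ?_
    filter_upwards [ae_restrict_of_ae hg0, ae_restrict_mem hΩ.measurableSet] with x hx hxΩ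
    by_cases hxU : x ∈ U
    · simp [hx ⟨hxU, hxΩ⟩]
    · rw [(hloc x hxΩ hxU).eq_of_nhds]
  rwa [e1, e2] at e

/-! ### The two inequalities -/

lemma tendsto_average_growing_cubes {Ω : Set Plane} {u : Plane → ℂ} (hu : IntegrableOn u Ω) :
    Filter.Tendsto (fun N : ℕ => (((N : ℝ) + 1) ^ 2)⁻¹ •
      ∫ x in Ω ∩ openCube 0 ((N : ℝ) + 1), u x) Filter.atTop (nhds 0) := by
  have h1 : Filter.Tendsto (fun N : ℕ => (((N : ℝ) + 1) ^ 2)⁻¹) Filter.atTop (nhds 0) := by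
    have := (tendsto_one_div_add_atTop_nhds_zero_nat (𝕜 := ℝ)).pow 2
    simpa using this
  refine squeeze_zero_norm (a := fun N : ℕ => (((N : ℝ) + 1) ^ 2)⁻¹ * ∫ x in Ω, ‖u x‖) (fun N => ?_)
    (by simpa using h1.mul_const (∫ x in Ω, ‖u x‖))
  rw [norm_smul, Real.norm_of_nonneg (by positivity)]
  gcongr
  exact (norm_integral_le_integral_norm _).trans (setIntegral_mono_set hu.norm
    (Filter.Eventually.of_forall fun x => norm_nonneg _) Set.inter_subset_left.eventuallyLE)

lemma eventually_mem_openCube (x : Plane) :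
    ∀ᶠ N : ℕ in Filter.atTop, x ∈ openCube 0 ((N : ℝ) + 1) := by
  filter_upwards [Filter.eventually_ge_atTop ⌈2 * ‖x‖⌉₊] with N hN i
  have h1 : 2 * ‖x‖ ≤ N := (Nat.le_ceil _).trans (by exact_mod_cast hN)
  have h2 : |x i| ≤ ‖x‖ := PiLp.norm_apply_le x i
  simp only [PiLp.zero_apply, sub_zero]
  linarith

lemma continuous_youngA : Continuous youngA := by
  unfold youngA
  fun_prop

theorem HasH10Grad.youngA_bound {Ω : Set Plane} (hΩ : IsOpen Ω) (hfin : volume Ω < ⊤)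
    {u : Plane → ℂ} {g : Plane → EuclideanSpace ℂ (Fin 2)} (h : HasH10Grad Ω u g) :
    (l2NormSq Ω g = 0 → ∀ᵐ x ∂(volume.restrict Ω), u x = 0) ∧
    (∫⁻ x in Ω, ENNReal.ofReal (youngA (1 / 13824 * ‖u x‖ ^ 2 / l2NormSq Ω g))) ≤ volume Ω := by
  have : IsFiniteMeasure (volume.restrict Ω) := ⟨by rwa [Measure.restrict_apply_univ]⟩
  have hΩm := hΩ.measurableSet
  have hu1 : IntegrableOn u Ω := h.memLp.integrable (by norm_num)
  have hcore := fun N : ℕ => lintegral_youngA_sub_le_of_extension hΩm h.memLp h.memLp_grad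
    (a := 0) (L := (N : ℝ) + 1) (by positivity) fun φ hφ i => h.integral_mul_partialDeriv hφ i
  have hQm : ∀ N : ℕ, MeasurableSet (openCube 0 ((N : ℝ) + 1)) :=
    fun N => (isOpen_openCube _ _).measurableSet
  have hc := tendsto_average_growing_cubes hu1
  set c : ℕ → ℂ := fun N => (((N : ℝ) + 1) ^ 2)⁻¹ • ∫ x in Ω ∩ openCube 0 ((N : ℝ) + 1), u x
  constructor
  · intro hD
    have h1 : ∀ N : ℕ, ∀ᵐ x ∂volume.restrict Ω, x ∈ openCube 0 ((N : ℝ) + 1) → u x = c N := by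
      intro N
      have : ∀ᵐ x ∂volume.restrict (Ω ∩ openCube 0 ((N : ℝ) + 1)), u x = c N := (hcore N).1 hD
      rwa [Set.inter_comm, ← Measure.restrict_restrict (hQm N), ae_restrict_iff' (hQm N)] at this
    filter_upwards [ae_all_iff.mpr h1] with x hx
    refine tendsto_nhds_unique (tendsto_const_nhds.congr' ?_) hc
    filter_upwards [eventually_mem_openCube x] with N hN using hx N hN
  · set F : ℕ → Plane → ℝ≥0∞ := fun N => (openCube 0 ((N : ℝ) + 1)).indicator fun x =>
      ENNReal.ofReal (youngA (1 / 13824 * ‖u x - c N‖ ^ 2 / l2NormSq Ω g))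
    have hFlim : ∀ x, Filter.Tendsto (fun N => F N x) Filter.atTop
        (nhds (ENNReal.ofReal (youngA (1 / 13824 * ‖u x‖ ^ 2 / l2NormSq Ω g)))) := by
      intro x
      have h1 : Filter.Tendsto (fun N => ENNReal.ofReal
          (youngA (1 / 13824 * ‖u x - c N‖ ^ 2 / l2NormSq Ω g))) Filter.atTop
          (nhds (ENNReal.ofReal (youngA (1 / 13824 * ‖u x - 0‖ ^ 2 / l2NormSq Ω g)))) :=
        ENNReal.tendsto_ofReal ((continuous_youngA.tendsto _).comp
          ((((hc.const_sub (u x)).norm.pow 2).const_mul _).div_const _))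
      rw [sub_zero] at h1
      refine h1.congr' ?_
      filter_upwards [eventually_mem_openCube x] with N hN
      simp only [F, Set.indicator_of_mem hN]
    have hum : AEMeasurable u (volume.restrict Ω) := hu1.aestronglyMeasurable.aemeasurable
    have hFm : ∀ N, AEMeasurable (F N) (volume.restrict Ω) := fun N =>
      ((continuous_youngA.measurable.comp_aemeasurable
        ((((hum.sub_const _).norm.pow_const 2).const_mul _).div_const _)).ennreal_ofReal).indicator
          (hQm N)
    calc _ = ∫⁻ x in Ω, Filter.liminf (fun N => F N x) Filter.atTop :=
          lintegral_congr fun x => (hFlim x).liminf_eq.symm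
      _ ≤ Filter.liminf (fun N => ∫⁻ x in Ω, F N x) Filter.atTop := lintegral_liminf_le' hFm
      _ ≤ volume Ω := by
          refine Filter.liminf_le_of_frequently_le'
            (Filter.Eventually.of_forall fun N => ?_).frequently
          rw [setLIntegral_indicator (hQm N), Set.inter_comm]
          exact (hcore N).2.trans (measure_mono Set.inter_subset_left)

theorem HasH1Grad.youngA_bound_of_vanishesNear {Ω : Set Plane} (hΩ : IsOpen Ω) {a : Plane} {L : ℝ}
    (hL : 0 < L) (hΩQ : Ω ⊆ openCube a L) {u : Plane → ℂ}
    {g : Plane → EuclideanSpace ℂ (Fin 2)} (h : HasH1Grad Ω u g)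
    (hv : VanishesNear Ω (openCube a L ∩ frontier Ω) u) (hmean : (∫ x in Ω, u x) = 0) :
    (l2NormSq Ω g = 0 → ∀ᵐ x ∂(volume.restrict Ω), u x = 0) ∧
    (∫⁻ x in Ω, ENNReal.ofReal (youngA (1 / 13824 * ‖u x‖ ^ 2 / l2NormSq Ω g))) ≤ volume Ω := by
  have hcore := lintegral_youngA_sub_le_of_extension hΩ.measurableSet h.memLp h.memLp_grad hL
    fun φ hφ i => h.integral_mul_partialDeriv_of_vanishesNear hΩ hv hφ i
  simpa only [Set.inter_eq_left.mpr hΩQ, hmean, smul_zero, sub_zero] using hcore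

theorem proposition2p1 :
    (∃ S₂ : ℝ, 0 < S₂ ∧
      ∀ Ω : Set Plane, IsOpen Ω → volume Ω < ⊤ →
      ∀ (u : Plane → ℂ) (gradu : Plane → EuclideanSpace ℂ (Fin 2)), HasH10Grad Ω u gradu →
        (l2NormSq Ω gradu = 0 → ∀ᵐ x ∂(volume.restrict Ω), u x = 0) ∧
        (∫⁻ x in Ω, ENNReal.ofReal (youngA (S₂ * ‖u x‖ ^ 2 / l2NormSq Ω gradu))) ≤ volume Ω) ∧
    (∃ S₂' : ℝ, 0 < S₂' ∧
      ∀ Ω : Set Plane, IsOpen Ω →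
      ∀ (a : Plane) (L : ℝ), 0 < L → Ω ⊆ openCube a L →
      ∀ (u : Plane → ℂ) (gradu : Plane → EuclideanSpace ℂ (Fin 2)), HasH1Grad Ω u gradu →
        VanishesNear Ω (openCube a L ∩ frontier Ω) u →
        (∫ x in Ω, u x) = 0 →
        (l2NormSq Ω gradu = 0 → ∀ᵐ x ∂(volume.restrict Ω), u x = 0) ∧
        (∫⁻ x in Ω, ENNReal.ofReal (youngA (S₂' * ‖u x‖ ^ 2 / l2NormSq Ω gradu))) ≤ volume Ω) :=
  ⟨⟨1 / 13824, by norm_num, fun _ hΩ hfin _ _ h => h.youngA_bound hΩ hfin⟩,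
    ⟨1 / 13824, by norm_num, fun _ hΩ _ _ hL hΩQ _ _ h hv hmean =>
      h.youngA_bound_of_vanishesNear hΩ hL hΩQ hv hmean⟩⟩
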